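/- Let $d, k, r \ge 1$ be integers with $k < \min\{d,r\}$. For a positive integer $n$ write $[n]=\{1,\dots,n\}$, and let $L(n,d,k,r)$ denote the number of ordered $r$-tuples of (not necessarily distinct) points of $[n]^d$ all of which lie in a common $k$-dimensional linear subspace of $\mathbb{R}^d$; equivalently, $L(n,d,k,r)$ is the number of $d\times r$ matrices of rank at most $k$ with all entries in $[n]$. Then, as $n\to\infty$ with $d,k,r$ fixed, $$L(n,d,k,r)=\begin{cases}\Theta\big(n^{k\max\{r,d\}}\big), & \text{if } r\neq d,\\ \Theta\big(n^{kd}\log n\big), & \text{if } r=d,\end{cases}$$ where the implied constants depend only on $d,k,r$. -/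

import Mathlib

open Filter Asymptotics

/-- The set of ordered `r`-tuples (repetitions allowed) of points of `[n]^d = {1, …, n}^d`
that all lie in a common `k`-dimensional linear subspace of `ℝ^d`. -/
def linearTuples (n d k r : ℕ) : Set (Fin r → Fin d → ℕ) :=
  {x | (∀ i j, x i j ∈ Finset.Icc 1 n) ∧
    ∃ W : Submodule ℝ (Fin d → ℝ), Module.finrank ℝ W = k ∧
      ∀ i, (fun j => (x i j : ℝ)) ∈ W}

/-- `L(n, d, k, r)`: the number of `r`-tuples of points of `[n]^d` that lie in a
`k`-dimensional linear subspace. -/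
noncomputable def linearCount (n d k r : ℕ) : ℕ :=
  (linearTuples n d k r).ncard

/-- The comparison function `l_{d,k,r}(n)`. -/
noncomputable def linearGrowth (d k r n : ℕ) : ℝ :=
  if r ≠ d then (n : ℝ) ^ (k * max r d) else (n : ℝ) ^ (k * d) * Real.log n

/-- The set of tuples being counted is finite, so that its `ncard` is its cardinality. -/
theorem linearTuples_finite (n d k r : ℕ) : (linearTuples n d k r).Finite := by
  refine (Set.Finite.pi' fun _ : Fin r =>
    Set.Finite.pi' fun _ : Fin d => (Finset.Icc 1 n).finite_toSet).subset ?_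
  intro x hx i j
  exact hx.1 i j

/-- A tuple lies in a `k`-dimensional linear subspace exactly when the `d × r` matrix having its
points as columns has rank at most `k`. -/
theorem linearTuples_eq_rank_le (n d k r : ℕ) (hk : k ≤ d) :
    linearTuples n d k r =
      {x | (∀ i j, x i j ∈ Finset.Icc 1 n) ∧
        (Matrix.of fun (j : Fin d) (i : Fin r) => (x i j : ℝ)).rank ≤ k} := by
  ext x
  refine and_congr_right fun _ => ?_
  rw [Matrix.rank_eq_finrank_span_cols]
  constructor
  · rintro ⟨W, hW, hx⟩
    rw [← hW]
    apply Submodule.finrank_mono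
    rw [Submodule.span_le]
    rintro _ ⟨i, rfl⟩
    exact hx i
  · intro h
    have key : ∀ m, m ≤ d → ∀ U : Submodule ℝ (Fin d → ℝ), Module.finrank ℝ U ≤ m →
        ∃ W, U ≤ W ∧ Module.finrank ℝ W = m := by
      intro m hm U hU
      obtain ⟨C, hC⟩ := U.exists_isCompl
      have hsum := Submodule.finrank_add_eq_of_isCompl hC
      rw [Module.finrank_fin_fun] at hsum
      obtain ⟨f, hf⟩ := exists_linearIndependent_of_le_finrank (R := ℝ) (M := C)
        (n := m - Module.finrank ℝ U) (by omega)
      have hf' : LinearIndependent ℝ (fun i => (f i : Fin d → ℝ)) :=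
        hf.map' C.subtype C.ker_subtype
      have hspan : Submodule.span ℝ (Set.range fun i => (f i : Fin d → ℝ)) ≤ C := by
        rw [Submodule.span_le]
        rintro _ ⟨i, rfl⟩
        exact (f i).2
      refine ⟨U ⊔ Submodule.span ℝ (Set.range fun i => (f i : Fin d → ℝ)), le_sup_left, ?_⟩
      have h1 := Submodule.finrank_sup_add_finrank_inf_eq U
        (Submodule.span ℝ (Set.range fun i => (f i : Fin d → ℝ)))
      rw [(hC.disjoint.mono_right hspan).eq_bot, finrank_bot, finrank_span_eq_card hf',
        Fintype.card_fin] at h1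
      omega
    obtain ⟨W, hW, hd⟩ := key k hk _ h
    exact ⟨W, hd, fun i => hW (Submodule.subset_span ⟨i, rfl⟩)⟩

/-! Rank is invariant under transposition, so it suffices to count `a × b` matrices with `a ≤ b`,
where `{a, b} = {r, d}`; the target is `n^(k b)`, with an extra `log n` when `a = b`.

Upper bound. In a matrix of rank `k`, choose `k` rows and `k` columns with nonzero minor, the rows
maximizing its absolute value for those columns. By Cramer's rule the remaining `a - k` rows are
combinations of the chosen ones with rational coefficients in `[-1, 1]` (`exists_maximal_minor`).
Read modulo 1, these coefficients give `k` torsion points `γ_l` of the torus `(ℝ/ℤ)^(a-k)`. Let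
`q_l` be the order of `γ_l` modulo the subgroup generated by the earlier ones. Two estimates carry
the argument. At most a constant times `∏ q_l^(a-1-l)` tuples `γ` have given `q`
(`relativeOrderTuples_card`). For fixed `γ`, every column restricted to the chosen rows lies in the
lattice of `x` with `∑ x_l γ_l = 0` in the torus, which has index `∏ q_l`. This lattice contains `k`
independent vectors of the box, so it meets the box in `O(n^k / ∏ q_l)` points
(`card_ker_mul_card_le`), and the fiber has `O(n^(k b) / ∏ q_l^b)` matrices. Summing `q_l^(a-1-l-b)`
over each `q_l` converges, except for `l = 0` and `a = b`, where the harmonic sum produces the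
logarithm. Smaller ranks contribute no more.

Lower bound. Repeating `k` arbitrary rows gives `n^(k b)`. If `a = b = d`, the logarithm comes from
coefficient matrices `C / q` whose rows are proportional modulo `q`: there are at least `φ(q)
q^(d-2)` of them, and the divisibility conditions on a column collapse to one congruence, leaving
about `n^k / q` columns. The total is of order `n^(k d) ∑ φ(q) / q^2`. A diagonally dominant block
ensures that no matrix is counted twice (`extendByNumerators_injective`). -/

/-! ### Relative orders and digit expansions in an abelian group -/

/-- Take `q i` to be the least positive multiplier sending `g i` into the span of the earlier
generators. Sums with digits below `q` then behave like a mixed-radix expansion: division with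
remainder gives existence, minimality gives uniqueness. -/
theorem exists_relative_orders {T : Type*} [AddCommGroup T] (g : ℕ → T)
    (hg : ∀ i, IsOfFinAddOrder (g i)) :
    ∃ q : ℕ → ℕ, (∀ i, 0 < q i) ∧
      (∀ i, ∃ a : ℕ → ℕ, (∀ l < i, a l < q l) ∧
        q i • g i = ∑ l ∈ Finset.range i, a l • g l) ∧
      ∀ k, ∀ b c : ℕ → ℕ, (∀ l < k, b l < q l) → (∀ l < k, c l < q l) →
        ∑ l ∈ Finset.range k, b l • g l = ∑ l ∈ Finset.range k, c l • g l →
        ∀ l < k, b l = c l := by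
  classical
  let P : ℕ → T → Prop := fun i x => ∃ z : ℕ → ℤ, x = ∑ l ∈ Finset.range i, z l • g l
  have hex : ∀ i, ∃ m : ℕ, 0 < m ∧ P i (m • g i) := fun i =>
    ⟨addOrderOf (g i), (hg i).addOrderOf_pos, 0, by simp [addOrderOf_nsmul_eq_zero]⟩
  let q : ℕ → ℕ := fun i => Nat.find (hex i)
  have hq0 : ∀ i, 0 < q i := fun i => (Nat.find_spec (hex i)).1
  have hqP : ∀ i, P i (q i • g i) := fun i => (Nat.find_spec (hex i)).2
  have hmin : ∀ i m, 0 < m → P i (m • g i) → q i ≤ m := fun i m h1 h2 =>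
    Nat.find_min' (hex i) ⟨h1, h2⟩
  have hred : ∀ i x, P i x → ∃ a : ℕ → ℕ, (∀ l < i, a l < q l) ∧
      x = ∑ l ∈ Finset.range i, a l • g l := by
    intro i
    induction i with
    | zero =>
      rintro x ⟨z, rfl⟩
      exact ⟨0, by simp, by simp⟩
    | succ i ih =>
      rintro x ⟨z, rfl⟩
      obtain ⟨w, hw⟩ := hqP i
      have hqi : (0 : ℤ) < q i := by exact_mod_cast hq0 i
      -- Divide the top coefficient by `q i` and carry the quotient down through the relation `hw`.
      obtain ⟨a, ha, hax⟩ := ih (∑ l ∈ Finset.range i, (z l + (z i / q i) * w l) • g l)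
        ⟨fun l => z l + (z i / q i) * w l, rfl⟩
      refine ⟨fun l => if l < i then a l else (z i % q i).toNat, ?_, ?_⟩
      · intro l hl
        by_cases h : l < i
        · simpa [h] using ha l h
        · obtain rfl : l = i := by omega
          have h1 := Int.emod_lt_of_pos (z l) hqi
          have h2 := Int.emod_nonneg (z l) hqi.ne'
          simp only [lt_irrefl, if_false]
          omega
      · rw [Finset.sum_range_succ, Finset.sum_range_succ]
        have e1 : ∑ l ∈ Finset.range i, (if l < i then a l else (z i % q i).toNat) • g l =
            ∑ l ∈ Finset.range i, a l • g l :=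
          Finset.sum_congr rfl fun l hl => by rw [if_pos (Finset.mem_range.1 hl)]
        rw [e1, ← hax]
        simp only [lt_irrefl, if_false, add_smul, Finset.sum_add_distrib, mul_smul]
        rw [← Finset.smul_sum, ← hw, add_assoc]
        congr 1
        have h2 := Int.emod_nonneg (z i) hqi.ne'
        rw [← natCast_zsmul (g i) (z i % q i).toNat, Int.toNat_of_nonneg h2,
          ← natCast_zsmul (g i) (q i), ← mul_smul, ← add_smul]
        congr 1
        have := Int.mul_ediv_add_emod (z i) (q i)
        linarith
  refine ⟨q, hq0, fun i => hred i _ (hqP i), ?_⟩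
  -- If the top digits differed, subtraction would put a positive multiple of `g k` smaller than `q
  -- k` into the earlier span.
  have hlt : ∀ k, ∀ b c : ℕ → ℕ, c k < q k → b k < c k →
      ∑ l ∈ Finset.range (k + 1), b l • g l ≠ ∑ l ∈ Finset.range (k + 1), c l • g l := by
    intro k b c hc hbc h
    rw [Finset.sum_range_succ, Finset.sum_range_succ] at h
    have := hmin k (c k - b k) (by omega) ⟨fun l => (b l : ℤ) - c l, by
      simp only [sub_smul, Finset.sum_sub_distrib, natCast_zsmul]
      rw [sub_nsmul _ hbc.le, ← sub_eq_add_neg, sub_eq_sub_iff_add_eq_add, h]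
      abel⟩
    omega
  intro k
  induction k with
  | zero => simp
  | succ k ih =>
    intro b c hb hc h
    have hk : b k = c k := by
      rcases lt_trichotomy (b k) (c k) with h1 | h1 | h1
      · exact absurd h (hlt k b c (hc k k.lt_succ_self) h1)
      · exact h1
      · exact absurd h.symm (hlt k c b (hb k k.lt_succ_self) h1)
    rw [Finset.sum_range_succ, Finset.sum_range_succ, hk] at h
    intro l hl
    rcases Nat.lt_succ_iff_lt_or_eq.1 hl with h1 | rfl
    · exact ih b c (fun l hl => hb l (by omega)) (fun l hl => hc l (by omega))
        (add_right_cancel h) l h1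
    · exact hk

theorem exists_relative_orders_fin {T : Type*} [AddCommGroup T] {k : ℕ} (g : Fin k → T)
    (hg : ∀ i, IsOfFinAddOrder (g i)) :
    ∃ q : Fin k → ℕ, (∀ i, 0 < q i) ∧
      (∀ i, ∃ a : Fin k → ℕ, (∀ l, l < i → a l < q l) ∧ (∀ l, i ≤ l → a l = 0) ∧
        q i • g i = ∑ l, a l • g l) ∧
      ∀ b c : Fin k → ℕ, (∀ l, b l < q l) → (∀ l, c l < q l) →
        ∑ l, b l • g l = ∑ l, c l • g l → b = c := by
  classical
  let G : ℕ → T := fun i => if h : i < k then g ⟨i, h⟩ else 0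
  have hG : ∀ i : Fin k, G i = g i := fun i => by simp [G]
  obtain ⟨q, hq, ha, hinj⟩ := exists_relative_orders G fun i => by
    by_cases h : i < k
    · simpa [G, h] using hg ⟨i, h⟩
    · simp [G, h]
  refine ⟨fun i => q i, fun i => hq i, fun i => ?_, ?_⟩
  · obtain ⟨a, h1, h2⟩ := ha i
    refine ⟨fun l => if l < i then a l else 0, fun l hl => ?_, fun l hl => ?_, ?_⟩
    · simpa [hl] using h1 l hl
    · simp [not_lt.2 hl]
    · rw [← hG, h2]
      have : ∑ l : Fin k, (if l < i then a l else 0) • g l =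
          ∑ l : Fin k, (fun l : ℕ => (if l < (i : ℕ) then a l else 0) • G l) l :=
        Finset.sum_congr rfl fun l _ => by simp [hG]
      rw [this, Fin.sum_univ_eq_sum_range (fun l : ℕ => (if l < (i : ℕ) then a l else 0) • G l)]
      rw [← Finset.sum_subset (Finset.range_subset_range.2 i.2.le)]
      · exact Finset.sum_congr rfl fun l hl => by rw [if_pos (Finset.mem_range.1 hl)]
      · intro l _ hl
        rw [if_neg (by simpa using hl), zero_smul]
  · intro b c hb hc h
    let ext : (Fin k → ℕ) → ℕ → ℕ := fun b l => if h : l < k then b ⟨l, h⟩ else 0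
    have hext : ∀ b (l : Fin k), ext b l = b l := fun b l => by simp [ext]
    have hsum : ∀ b : Fin k → ℕ, ∑ l ∈ Finset.range k, ext b l • G l = ∑ l, b l • g l := by
      intro b
      rw [← Fin.sum_univ_eq_sum_range (fun l : ℕ => ext b l • G l)]
      exact Finset.sum_congr rfl fun l _ => by rw [hext, hG]
    funext l
    have := hinj k (ext b) (ext c) (fun l hl => by simpa [ext, hl] using hb ⟨l, hl⟩)
      (fun l hl => by simpa [ext, hl] using hc ⟨l, hl⟩) (by rw [hsum, hsum, h]) l l.2
    rwa [hext, hext] at this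

/-! ### Lattice points in a box -/

/-- Write `b` in the real basis `v` and subtract the integer parts of its coordinates; the remainder
combines `k` vectors of `[0, n]^k` with coefficients in `[0, 1)`. -/
theorem exists_reduction_mod_vectors {k : ℕ} (n : ℕ) (v : Matrix (Fin k) (Fin k) ℤ)
    (hbox : ∀ i j, 0 ≤ v i j ∧ v i j ≤ n) (hdet : v.det ≠ 0) (b : Fin k → ℤ) :
    ∃ z : Fin k → ℤ, ∀ j, 0 ≤ (b - ∑ i, z i • v i) j ∧ (b - ∑ i, z i • v i) j ≤ k * n := by
  let V : Matrix (Fin k) (Fin k) ℝ := v.map (Int.cast : ℤ → ℝ)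
  have hV : IsUnit V.det := by
    have : V.det = (v.det : ℝ) := by
      simpa [V] using (Int.cast_det v (R := ℝ)).symm
    rw [this]
    exact isUnit_iff_ne_zero.2 (by exact_mod_cast hdet)
  let β : Fin k → ℝ := fun j => b j
  let t : Fin k → ℝ := Matrix.vecMul β V⁻¹
  have ht : ∀ j, (b j : ℝ) = ∑ i, t i * v i j := by
    intro j
    have : Matrix.vecMul t V = β := by
      rw [Matrix.vecMul_vecMul, Matrix.nonsing_inv_mul _ hV, Matrix.vecMul_one]
    have := congrFun this j
    simp only [Matrix.vecMul, dotProduct, V, Matrix.map_apply, β] at this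
    exact this.symm
  refine ⟨fun i => ⌊t i⌋, fun j => ?_⟩
  have key : (((b - ∑ i, ⌊t i⌋ • v i) j : ℤ) : ℝ) = ∑ i, Int.fract (t i) * v i j := by
    simp only [Pi.sub_apply, Finset.sum_apply, Pi.smul_apply, smul_eq_mul]
    push_cast
    rw [ht j, ← Finset.sum_sub_distrib]
    exact Finset.sum_congr rfl fun i _ => by rw [← Int.self_sub_floor]; ring
  have hv0 : ∀ i, (0 : ℝ) ≤ v i j := fun i => by exact_mod_cast (hbox i j).1
  have hv1 : ∀ i, (v i j : ℝ) ≤ n := fun i => by exact_mod_cast (hbox i j).2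
  constructor
  · have : (0 : ℝ) ≤ ((b - ∑ i, ⌊t i⌋ • v i) j : ℤ) := by
      rw [key]
      exact Finset.sum_nonneg fun i _ => mul_nonneg (Int.fract_nonneg _) (hv0 i)
    exact_mod_cast this
  · have : (((b - ∑ i, ⌊t i⌋ • v i) j : ℤ) : ℝ) ≤ k * n := by
      rw [key]
      calc ∑ i, Int.fract (t i) * v i j ≤ ∑ _i : Fin k, (n : ℝ) :=
            Finset.sum_le_sum fun i _ =>
              (mul_le_of_le_one_left (hv0 i) (Int.fract_lt_one _).le).trans (hv1 i)
        _ = k * n := by simp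
    exact_mod_cast this

/-- A packing argument: reduce the coset representatives `B` modulo the kernel vectors `v` into `[0,
k n]^k`. Adding points of `X` yields distinct points of `[0, (k + 1) n]^k`, since `φ` recovers the
representative and then the kernel point. -/
theorem card_ker_mul_card_le {k : ℕ} {T : Type*} [AddCommGroup T] (φ : (Fin k → ℤ) →+ T) (n : ℕ)
    (v : Matrix (Fin k) (Fin k) ℤ) (hv : ∀ i, φ (v i) = 0)
    (hbox : ∀ i j, 0 ≤ v i j ∧ v i j ≤ n) (hdet : v.det ≠ 0)
    (X B : Finset (Fin k → ℤ)) (hX : ∀ x ∈ X, φ x = 0 ∧ ∀ j, 0 ≤ x j ∧ x j ≤ n)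
    (hB : Set.InjOn φ B) :
    X.card * B.card ≤ ((k + 1) * n + 1) ^ k := by
  choose z hz using exists_reduction_mod_vectors n v hbox hdet
  have hφ : ∀ b, φ (b - ∑ i, z b i • v i) = φ b := by
    intro b
    rw [map_sub, map_sum, Finset.sum_eq_zero fun i _ => ?_, sub_zero]
    rw [map_zsmul, hv, smul_zero]
  have hcard : (Fintype.piFinset fun _ : Fin k => Finset.Icc (0 : ℤ) ((k + 1) * n)).card =
      ((k + 1) * n + 1) ^ k := by
    simp only [Fintype.card_piFinset, Int.card_Icc, Finset.prod_const, Finset.card_univ,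
      Fintype.card_fin]
    congr 1
  rw [← Finset.card_product, ← hcard]
  refine Finset.card_le_card_of_injOn (fun p => p.1 + (p.2 - ∑ i, z p.2 i • v i)) ?_ ?_
  · rintro ⟨x, b⟩ hp
    obtain ⟨hx, -⟩ := Finset.mem_product.1 hp
    simp only [Finset.mem_coe, Fintype.mem_piFinset, Finset.mem_Icc]
    intro j
    have h1 := (hX x hx).2 j
    have h2 := hz b j
    rw [Pi.add_apply]
    constructor <;> nlinarith
  · rintro ⟨x, b⟩ hp ⟨y, c⟩ hp' h
    obtain ⟨hx, hb⟩ := Finset.mem_product.1 hp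
    obtain ⟨hy, hc⟩ := Finset.mem_product.1 hp'
    simp only at h hx hb hy hc
    have h1 := congrArg φ h
    rw [map_add, map_add, hφ, hφ, (hX x hx).1, (hX y hy).1, zero_add, zero_add] at h1
    obtain rfl := hB hb hc h1
    rw [add_left_inj] at h
    rw [h]

/-! ### Maximal minors and Cramer's rule -/

theorem exists_linearIndependent_rows {m n k : ℕ} (A : Matrix (Fin m) (Fin n) ℝ)
    (hA : A.rank = k) :
    ∃ e : Fin k → Fin m, LinearIndependent ℝ fun i => A (e i) := by
  obtain ⟨κ, a, ha, hspan, hli⟩ := exists_linearIndependent' ℝ A.row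
  have : Finite κ := Finite.of_injective a ha
  have := Fintype.ofFinite κ
  have hc : Fintype.card κ = k := by
    rw [← hA, Matrix.rank_eq_finrank_span_row, ← hspan, finrank_span_eq_card hli]
  let E := Fintype.equivFinOfCardEq hc
  exact ⟨fun i => a (E.symm i), hli.comp E.symm E.symm.injective⟩

theorem exists_det_submatrix_ne_zero {m n k : ℕ} (A : Matrix (Fin m) (Fin n) ℝ)
    (hA : A.rank = k) :
    ∃ (e : Fin k → Fin m) (f : Fin k → Fin n), (A.submatrix e f).det ≠ 0 := by
  obtain ⟨e, he⟩ := exists_linearIndependent_rows A hA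
  have h1 : (A.submatrix e id).transpose.rank = k := by
    rw [Matrix.rank_transpose]
    have := LinearIndependent.rank_matrix (M := A.submatrix e id) he
    rw [this, Fintype.card_fin]
  obtain ⟨f, hf⟩ := exists_linearIndependent_rows _ h1
  refine ⟨e, f, ?_⟩
  have : IsUnit ((A.submatrix e f).transpose) := Matrix.linearIndependent_rows_iff_isUnit.1 hf
  rw [Matrix.isUnit_iff_isUnit_det, Matrix.det_transpose] at this
  exact this.ne_zero

theorem exists_eq_mul_submatrix {m n k : ℕ} (A : Matrix (Fin m) (Fin n) ℝ) (hA : A.rank = k)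
    (e : Fin k → Fin m) (f : Fin k → Fin n) (h : (A.submatrix e f).det ≠ 0) :
    ∃ C : Matrix (Fin m) (Fin k) ℝ, ∀ i j, A i j = ∑ l, C i l * A (e l) j := by
  have hli : LinearIndependent ℝ fun i => A (e i) := by
    have h1 : IsUnit (A.submatrix e f) := by
      rw [Matrix.isUnit_iff_isUnit_det]; exact h.isUnit
    have h2 := Matrix.linearIndependent_rows_iff_isUnit.2 h1
    have h3 : (A.submatrix e f).row = (LinearMap.funLeft ℝ ℝ f) ∘ fun i => A (e i) := by
      funext i j; rfl
    rw [h3] at h2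
    exact LinearIndependent.of_comp _ h2
  have hspan : Submodule.span ℝ (Set.range fun i => A (e i)) = Submodule.span ℝ (Set.range A.row) := by
    apply Submodule.eq_of_le_of_finrank_eq
    · apply Submodule.span_mono
      rintro _ ⟨i, rfl⟩
      exact ⟨e i, rfl⟩
    · rw [finrank_span_eq_card hli, Fintype.card_fin, ← Matrix.rank_eq_finrank_span_row, hA]
  have hmem : ∀ i, ∃ c : Fin k → ℝ, ∑ l, c l • A (e l) = A i := fun i => by
    have : A i ∈ Submodule.span ℝ (Set.range fun i => A (e i)) := by
      rw [hspan]; exact Submodule.subset_span ⟨i, rfl⟩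
    exact (Submodule.mem_span_range_iff_exists_fun ℝ).1 this
  choose c hc using hmem
  refine ⟨c, fun i j => ?_⟩
  rw [← hc i]
  simp [Finset.sum_apply]

theorem det_update_submatrix {m n k : ℕ} (A : Matrix (Fin m) (Fin n) ℝ)
    (e : Fin k → Fin m) (f : Fin k → Fin n) (C : Matrix (Fin m) (Fin k) ℝ)
    (hC : ∀ i j, A i j = ∑ l, C i l * A (e l) j) (i : Fin m) (l : Fin k) :
    (A.submatrix (Function.update e l i) f).det = C i l * (A.submatrix e f).det := by
  have h : A.submatrix (Function.update e l i) f =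
      (A.submatrix e f).updateRow l (∑ l', C i l' • (A.submatrix e f) l') := by
    ext a b
    by_cases ha : a = l
    · subst ha
      simp [hC i]
    · simp [ha]
  rw [h, Matrix.det_updateRow_sum, smul_eq_mul]

/-- A matrix of rank `k` is determined by `k` of its rows together with coefficients of absolute
value at most `1` whose products with a nonzero `k`-minor are again `k`-minors. -/
theorem exists_maximal_minor {m n k : ℕ} (A : Matrix (Fin m) (Fin n) ℝ) (hA : A.rank = k) :
    ∃ (e : Fin k → Fin m) (f : Fin k → Fin n) (C : Matrix (Fin m) (Fin k) ℝ),
      Function.Injective e ∧ (A.submatrix e f).det ≠ 0 ∧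
      (∀ i j, A i j = ∑ l, C i l * A (e l) j) ∧
      (∀ i l, |C i l| ≤ 1) ∧
      ∀ i l, C i l * (A.submatrix e f).det = (A.submatrix (Function.update e l i) f).det := by
  obtain ⟨e₀, f, h₀⟩ := exists_det_submatrix_ne_zero A hA
  have : Nonempty (Fin k → Fin m) := ⟨e₀⟩
  -- Only the rows vary: each coefficient is a quotient of two minors on the same columns `f`, so
  -- this maximality already bounds it by 1.
  obtain ⟨e, he⟩ := Finite.exists_max fun e : Fin k → Fin m => |(A.submatrix e f).det|
  have hdet : (A.submatrix e f).det ≠ 0 := by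
    have := (abs_pos.2 h₀).trans_le (he e₀)
    exact abs_pos.1 this
  obtain ⟨C, hC⟩ := exists_eq_mul_submatrix A hA e f hdet
  refine ⟨e, f, C, ?_, hdet, hC, fun i l => ?_, fun i l => (det_update_submatrix A e f C hC i l).symm⟩
  · intro a b hab
    by_contra hne
    exact hdet (Matrix.det_zero_of_row_eq hne (by funext j; simp [hab]))
  · have h1 := he (Function.update e l i)
    simp only [det_update_submatrix A e f C hC i l, abs_mul] at h1
    exact le_of_mul_le_mul_right (by simpa using h1) (abs_pos.2 hdet)

/-! ### Torsion tuples in the torus -/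

/-- Tuples of vectors in the cube `[-1, 1]^S` whose relative orders modulo `ℤ^S` divide
the prescribed numbers `q`. -/
def relativeOrderTuples {k : ℕ} (S : Type*) (q : Fin k → ℕ) : Set (Fin k → S → ℝ) :=
  {γ | (∀ l s, |γ l s| ≤ 1) ∧ ∀ i, ∃ a : Fin k → ℕ, (∀ l, l < i → a l < q l) ∧
    (∀ l, i ≤ l → a l = 0) ∧ ∀ s, ∃ z : ℤ, q i * γ i s = ∑ l, a l * γ l s + z}

/-- Encode `γ` by its relation coefficients and the integers `⌊q i * γ i s⌋`. The bound `q l`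
applies to one coefficient in each of the `k - 1 - l` later relations, and each floor takes at most
`2 q l + 1 ≤ 3 q l` values. -/
theorem relativeOrderTuples_card {k : ℕ} {S : Type*} [Fintype S] (q : Fin k → ℕ)
    (hq : ∀ i, 0 < q i) :
    (relativeOrderTuples S q).Finite ∧ (relativeOrderTuples S q).ncard ≤
      ∏ l : Fin k, 3 ^ Fintype.card S * q l ^ (Fintype.card S + (k - 1 - l)) := by
  classical
  let A : Finset (Fin k → Fin k → ℕ) := Fintype.piFinset fun i => Fintype.piFinset fun l =>
    if l < i then Finset.range (q l) else {0}
  let F : Finset (Fin k → S → ℤ) := Fintype.piFinset fun i => Fintype.piFinset fun _ =>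
    Finset.Icc (-(q i : ℤ)) (q i)
  have hex : ∀ γ : Fin k → S → ℝ, ∃ a : Fin k → Fin k → ℕ, γ ∈ relativeOrderTuples S q →
      a ∈ A ∧ ∀ i s, ∃ z : ℤ, q i * γ i s = ∑ l, a i l * γ l s + z := by
    intro γ
    by_cases hγ : γ ∈ relativeOrderTuples S q
    · choose a h1 h2 h3 using hγ.2
      refine ⟨a, fun _ => ⟨?_, h3⟩⟩
      simp only [A, Fintype.mem_piFinset]
      intro i l
      by_cases h : l < i
      · simpa [h] using h1 i l h
      · simpa [h] using h2 i l (not_lt.1 h)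
    · exact ⟨0, fun h => absurd h hγ⟩
  choose a ha using hex
  let code : (Fin k → S → ℝ) → (Fin k → Fin k → ℕ) × (Fin k → S → ℤ) := fun γ =>
    (a γ, fun i s => ⌊q i * γ i s⌋)
  have hmaps : Set.MapsTo code (relativeOrderTuples S q) (A ×ˢ F : Finset _) := by
    intro γ hγ
    simp only [Finset.mem_coe, Finset.mem_product]
    refine ⟨(ha γ hγ).1, ?_⟩
    simp only [F, code, Fintype.mem_piFinset, Finset.mem_Icc]
    intro i s
    have h := abs_le.1 (hγ.1 i s)
    have hqi : (0 : ℝ) ≤ q i := Nat.cast_nonneg _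
    constructor
    · rw [Int.le_floor]; push_cast; nlinarith
    · have : (⌊(q i : ℝ) * γ i s⌋ : ℝ) ≤ q i := (Int.floor_le _).trans (by nlinarith)
      exact_mod_cast this
  have hinj : Set.InjOn code (relativeOrderTuples S q) := by
    intro γ hγ γ' hγ' h
    obtain ⟨h1, h2⟩ := Prod.mk.inj h
    -- Decode in order: the earlier vectors and the relation fix `q i * γ i` modulo 1, and the floor
    -- fixes its integer part.
    have key : ∀ N, ∀ i : Fin k, (i : ℕ) < N → γ i = γ' i := by
      intro N
      induction N with
      | zero => intro i hi; omega
      | succ N ih =>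
        intro i hi
        funext s
        obtain ⟨z, hz⟩ := (ha γ hγ).2 i s
        obtain ⟨z', hz'⟩ := (ha γ' hγ').2 i s
        have hA := (ha γ hγ).1
        simp only [A, Fintype.mem_piFinset] at hA
        have hs : ∑ l, (a γ i l : ℝ) * γ l s = ∑ l, (a γ' i l : ℝ) * γ' l s := by
          refine Finset.sum_congr rfl fun l _ => ?_
          rw [← h1]
          by_cases hl : l < i
          · rw [ih l (by have : (l : ℕ) < i := hl; omega)]
          · have := hA i l
            rw [if_neg hl, Finset.mem_singleton] at this
            simp [this]
        have hf : ⌊q i * γ i s⌋ = ⌊q i * γ' i s⌋ := congrFun (congrFun h2 i) s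
        rw [hz, hz', hs, Int.floor_add_intCast, Int.floor_add_intCast, add_right_inj] at hf
        rw [hs, hf, ← hz'] at hz
        exact mul_left_cancel₀ (by exact_mod_cast (hq i).ne') hz
    funext i
    exact key _ i (Nat.lt_succ_self _)
  have hfin : (relativeOrderTuples S q).Finite :=
    Set.Finite.of_injOn hmaps hinj (Finset.finite_toSet _)
  refine ⟨hfin, ?_⟩
  have hle := Set.ncard_le_ncard_of_injOn code hmaps hinj (Finset.finite_toSet _)
  rw [Set.ncard_coe_finset, Finset.card_product] at hle
  refine hle.trans ?_
  have hAcard : A.card = ∏ l : Fin k, q l ^ (k - 1 - (l : ℕ)) := by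
    simp only [A, Fintype.card_piFinset]
    rw [Finset.prod_comm]
    refine Finset.prod_congr rfl fun l _ => ?_
    have : ∀ i, (if l < i then Finset.range (q l) else {0}).card = if l < i then q l else 1 := by
      intro i; split_ifs <;> simp
    simp only [this]
    rw [Finset.prod_ite, Finset.prod_const_one, mul_one, Finset.prod_const]
    congr 1
    rw [Finset.filter_lt_eq_Ioi, Fin.card_Ioi]
  have hFcard : F.card ≤ ∏ l : Fin k, (3 * q l) ^ Fintype.card S := by
    simp only [F, Fintype.card_piFinset, Int.card_Icc, Finset.prod_const, Finset.card_univ]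
    refine Finset.prod_le_prod' fun i _ => Nat.pow_le_pow_left ?_ _
    have := hq i
    omega
  calc A.card * F.card ≤ (∏ l : Fin k, q l ^ (k - 1 - (l : ℕ))) *
        ∏ l : Fin k, (3 * q l) ^ Fintype.card S := by
        rw [hAcard]; exact Nat.mul_le_mul_left _ hFcard
    _ = _ := by
      rw [← Finset.prod_mul_distrib]
      refine Finset.prod_congr rfl fun l _ => ?_
      rw [mul_pow, pow_add]; ring

/-- The homomorphism `x ↦ ∑ x_l γ_l` into the torus `(ℝ/ℤ)^S`. -/
noncomputable def torusHom {k : ℕ} {S : Type*} (γ : Fin k → S → ℝ) :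
    (Fin k → ℤ) →+ (S → AddCircle (1 : ℝ)) :=
  AddMonoidHom.mk' (fun x s => ((∑ l, x l * γ l s : ℝ) : AddCircle (1 : ℝ))) (by
    intro x y
    funext s
    simp only [Pi.add_apply, ← AddCircle.coe_add]
    congr 1
    rw [← Finset.sum_add_distrib]
    exact Finset.sum_congr rfl fun l _ => by push_cast; ring)

theorem torusHom_eq_zero_iff {k : ℕ} {S : Type*} (γ : Fin k → S → ℝ) (x : Fin k → ℤ) :
    torusHom γ x = 0 ↔ ∀ s, ∃ z : ℤ, ∑ l, x l * γ l s = z := by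
  rw [funext_iff]
  refine forall_congr' fun s => ?_
  change ((∑ l, x l * γ l s : ℝ) : AddCircle (1 : ℝ)) = 0 ↔ _
  rw [AddCircle.coe_eq_zero_iff]
  simp [eq_comm]

theorem torusHom_natCast {k : ℕ} {S : Type*} (γ : Fin k → S → ℝ) (x : Fin k → ℕ) :
    torusHom γ (fun l => (x l : ℤ)) = ∑ l, x l • fun s => (γ l s : AddCircle (1 : ℝ)) := by
  funext s
  change ((∑ l, ((x l : ℤ) : ℝ) * γ l s : ℝ) : AddCircle (1 : ℝ)) = _
  rw [Finset.sum_apply]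
  simp only [Pi.smul_apply, ← AddCircle.coe_nsmul]
  have h := map_sum (QuotientAddGroup.mk' (AddSubgroup.zmultiples (1 : ℝ)))
    (fun l => x l • γ l s) Finset.univ
  refine Eq.trans ?_ h
  simp [nsmul_eq_mul]

/-! ### Fibering matrices of rank `k` over their coefficients -/

/-- Matrices with entries in `{1, …, n}` whose rank is exactly `k`. -/
def rankMatrices (n a b k : ℕ) : Set (Fin a → Fin b → ℕ) :=
  {A | (∀ i j, A i j ∈ Finset.Icc 1 n) ∧ (Matrix.of fun i j => (A i j : ℝ)).rank = k}

/-- Matrices with entries in `{1, …, n}` of rank `k` whose rows outside `Set.range e` are the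
combinations of the rows `e l` with coefficients `γ l`. -/
def rankFiber (n : ℕ) {a b k : ℕ} (e : Fin k → Fin a)
    (γ : Fin k → {s // s ∉ Set.range e} → ℝ) : Set (Fin a → Fin b → ℕ) :=
  {A | (∀ i j, A i j ∈ Finset.Icc 1 n) ∧
    (∀ (s : {s // s ∉ Set.range e}) (j), (A s j : ℝ) = ∑ l, (A (e l) j : ℝ) * γ l s) ∧
    ∃ f : Fin k → Fin b, (Matrix.of fun i j => (A (e i) (f j) : ℤ)).det ≠ 0}

/-- By Cramer's rule the integer minor `D` clears all denominators, so the coefficients are torsion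
modulo 1 and relative orders exist. The final injectivity supplies the `∏ q` cosets used to bound
the fiber. -/
theorem exists_mem_rankFiber {n a b k : ℕ} {A : Fin a → Fin b → ℕ}
    (hA : A ∈ rankMatrices n a b k) :
    ∃ e : Fin k → Fin a, Function.Injective e ∧ ∃ q : Fin k → ℕ, (∀ i, 0 < q i) ∧
      ∃ γ ∈ relativeOrderTuples {s // s ∉ Set.range e} q, A ∈ rankFiber n e γ ∧
        Set.InjOn (fun x : Fin k → ℕ => torusHom γ fun l => (x l : ℤ)) {x | ∀ l, x l < q l} := by
  obtain ⟨hbox, hrank⟩ := hA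
  obtain ⟨e, f, C, he, hdet, hC, hC1, hCdet⟩ := exists_maximal_minor _ hrank
  simp only [Matrix.of_apply] at hC
  have hint : ∀ e' : Fin k → Fin a,
      ((Matrix.of fun i j => (A i j : ℝ)).submatrix e' f).det =
        ((Matrix.of fun i j => (A (e' i) (f j) : ℤ)).det : ℝ) := by
    intro e'
    rw [Int.cast_det]
    congr 1
  rw [hint] at hdet
  simp only [hint] at hCdet
  let γ : Fin k → {s // s ∉ Set.range e} → ℝ := fun l s => C s l
  set D := (Matrix.of fun i j => (A (e i) (f j) : ℤ)).det with hD
  have hD0 : D ≠ 0 := by exact_mod_cast hdet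
  obtain ⟨q, hq, ha, hinj⟩ := exists_relative_orders_fin
    (fun l => (fun s => (γ l s : AddCircle (1 : ℝ)))) (fun l => by
      rw [isOfFinAddOrder_iff_zsmul_eq_zero]
      refine ⟨D, hD0, ?_⟩
      funext s
      rw [Pi.smul_apply, ← AddCircle.coe_zsmul, Pi.zero_apply, AddCircle.coe_eq_zero_iff]
      refine ⟨(Matrix.of fun i j => (A (Function.update e l s i) (f j) : ℤ)).det, ?_⟩
      rw [zsmul_eq_mul, mul_one, zsmul_eq_mul, ← hCdet s l, mul_comm])
  refine ⟨e, he, q, hq, γ, ⟨fun l s => hC1 s l, fun i => ?_⟩, ⟨hbox, fun s j => ?_, f, hD0⟩, ?_⟩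
  · obtain ⟨a', h1, h2, h3⟩ := ha i
    refine ⟨a', h1, h2, fun s => ?_⟩
    have h4 : torusHom γ ((fun l => ((Pi.single i (q i) : Fin k → ℕ) l : ℤ)) -
        fun l => (a' l : ℤ)) = 0 := by
      rw [map_sub, torusHom_natCast, torusHom_natCast, sub_eq_zero, ← h3]
      rw [Finset.sum_eq_single i (fun l _ hl => by simp [hl]) (by simp)]
      simp
    obtain ⟨z, hz⟩ := (torusHom_eq_zero_iff _ _).1 h4 s
    refine ⟨z, ?_⟩
    rw [← hz]
    simp only [Pi.sub_apply, Int.cast_sub, sub_mul, Finset.sum_sub_distrib, Int.cast_natCast]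
    have h5 : ∑ l, (((Pi.single i (q i) : Fin k → ℕ) l : ℕ) : ℝ) * γ l s = q i * γ i s := by
      rw [Finset.sum_eq_single i (fun l _ hl => by simp [hl]) (by simp)]
      simp
    rw [h5]
    ring
  · rw [hC s j]
    exact Finset.sum_congr rfl fun l _ => mul_comm _ _
  · intro x hx y hy hxy
    simp only [torusHom_natCast] at hxy
    exact hinj x y hx hy hxy

/-- A matrix in the fiber is determined by its rows `e`, whose columns all lie in the kernel of
`torusHom γ`. Any member provides the nonsingular block needed for the packing bound, which is
applied to each of the `b` columns. -/
theorem rankFiber_bound {n a b k : ℕ} (e : Fin k → Fin a)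
    (γ : Fin k → {s // s ∉ Set.range e} → ℝ) (q : Fin k → ℕ)
    (hinj : Set.InjOn (fun x : Fin k → ℕ => torusHom γ fun l => (x l : ℤ)) {x | ∀ l, x l < q l})
    (hne : (rankFiber (b := b) n e γ).Nonempty) :
    ∏ l, q l ≤ ((k + 1) * n + 1) ^ k ∧
      (rankFiber (b := b) n e γ).ncard * (∏ l, q l) ^ b ≤ (((k + 1) * n + 1) ^ k) ^ b := by
  classical
  let X : Finset (Fin k → ℤ) := (Fintype.piFinset fun _ => Finset.Icc (0 : ℤ) n).filter
    fun x => torusHom γ x = 0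
  have hcol : ∀ A ∈ rankFiber (b := b) n e γ, ∀ j, (fun l => (A (e l) j : ℤ)) ∈ X := by
    intro A hA j
    simp only [X, Finset.mem_filter, Fintype.mem_piFinset, Finset.mem_Icc]
    refine ⟨fun l => ⟨by positivity, by exact_mod_cast (Finset.mem_Icc.1 (hA.1 (e l) j)).2⟩, ?_⟩
    rw [torusHom_eq_zero_iff]
    exact fun s => ⟨A s j, by rw [Int.cast_natCast, hA.2.1 s j]; simp⟩
  let B : Finset (Fin k → ℤ) := (Fintype.piFinset fun l => Finset.range (q l)).image
    fun x l => (x l : ℤ)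
  have hBcard : B.card = ∏ l, q l := by
    rw [Finset.card_image_of_injective _ (fun x y h => by
      funext l; exact_mod_cast congrFun h l), Fintype.card_piFinset]
    simp
  have hBinj : Set.InjOn (torusHom γ) B := by
    intro x hx y hy hxy
    obtain ⟨x', hx', rfl⟩ := Finset.mem_image.1 hx
    obtain ⟨y', hy', rfl⟩ := Finset.mem_image.1 hy
    simp only [Fintype.mem_piFinset, Finset.mem_range] at hx' hy'
    rw [hinj hx' hy' hxy]
  have hXB : X.card * ∏ l, q l ≤ ((k + 1) * n + 1) ^ k := by
    obtain ⟨A, hA⟩ := hne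
    obtain ⟨f, hf⟩ := hA.2.2
    rw [← hBcard]
    refine card_ker_mul_card_le (torusHom γ) n
      (Matrix.of fun i j => (A (e i) (f j) : ℤ)).transpose (fun i => ?_) (fun i j => ?_)
      (by rwa [Matrix.det_transpose]) X B (fun x hx => ?_) hBinj
    · exact (Finset.mem_filter.1 (hcol A hA (f i))).2
    · have := (Finset.mem_filter.1 (hcol A hA (f i))).1
      exact Finset.mem_Icc.1 (Fintype.mem_piFinset.1 this j)
    · obtain ⟨h1, h2⟩ := Finset.mem_filter.1 hx
      exact ⟨h2, fun j => Finset.mem_Icc.1 (Fintype.mem_piFinset.1 h1 j)⟩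
  -- Nonemptiness of `X` turns the packing bound into a bound on `∏ q` alone, making the range of
  -- `q` finite.
  have h0 : (0 : Fin k → ℤ) ∈ X := by
    simp only [X, Finset.mem_filter, Fintype.mem_piFinset, Finset.mem_Icc]
    exact ⟨fun l => by simp, map_zero _⟩
  refine ⟨(Nat.le_mul_of_pos_left _ (Finset.card_pos.2 ⟨0, h0⟩)).trans hXB, ?_⟩
  have hle : (rankFiber (b := b) n e γ).ncard ≤ X.card ^ b := by
    have h1 : (Fintype.piFinset fun _ : Fin b => X).card = X.card ^ b := by simp
    rw [← h1, ← Set.ncard_coe_finset]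
    refine Set.ncard_le_ncard_of_injOn (fun A j l => (A (e l) j : ℤ)) ?_ ?_ (Finset.finite_toSet _)
    · intro A hA
      simpa using hcol A hA
    · intro A hA A' hA' h
      have hrow : ∀ l j, A (e l) j = A' (e l) j := fun l j =>
        Nat.cast_injective (R := ℤ) (congrFun (congrFun h j) l)
      funext i j
      by_cases hi : i ∈ Set.range e
      · obtain ⟨l, rfl⟩ := hi
        exact hrow l j
      · have h1 := hA.2.1 ⟨i, hi⟩ j
        have h2 := hA'.2.1 ⟨i, hi⟩ j
        simp only [hrow] at h1
        exact_mod_cast h1.trans h2.symm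
  calc _ ≤ X.card ^ b * (∏ l, q l) ^ b := Nat.mul_le_mul_right _ hle
    _ = (X.card * ∏ l, q l) ^ b := (mul_pow _ _ _).symm
    _ ≤ _ := Nat.pow_le_pow_left hXB b

/-! ### Upper bound: summing over the orders -/

theorem sum_Icc_inv_sq_le (M : ℕ) : ∑ q ∈ Finset.Icc 1 M, (1 : ℝ) / (q : ℝ) ^ 2 ≤ 2 := by
  have h : ∀ M : ℕ, ∑ q ∈ Finset.Icc 1 (M + 1), (1 : ℝ) / (q : ℝ) ^ 2 ≤ 2 - 1 / (M + 1) := by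
    intro M
    induction M with
    | zero => norm_num
    | succ M ih =>
      rw [Finset.sum_Icc_succ_top (by omega)]
      refine (add_le_add_left ih _).trans ?_
      push_cast
      have h0 : (0 : ℝ) ≤ M := Nat.cast_nonneg M
      have : (1 : ℝ) / (M + 1 + 1) ^ 2 ≤ 1 / (M + 1) - 1 / (M + 1 + 1) := by
        rw [div_sub_div _ _ (by positivity) (by positivity), div_le_div_iff₀ (by positivity) (by positivity)]
        nlinarith
      linarith
  cases M with
  | zero => simp
  | succ M =>
    refine (h M).trans ?_
    have : (0 : ℝ) ≤ 1 / (M + 1) := by positivity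
    linarith

theorem sum_Icc_inv_le (M : ℕ) : ∑ q ∈ Finset.Icc 1 M, (1 : ℝ) / q ≤ 1 + Real.log M := by
  have := harmonic_le_one_add_log M
  rw [harmonic_eq_sum_Icc] at this
  push_cast at this
  simpa [one_div] using this

theorem rankMatrices_finite (n a b k : ℕ) : (rankMatrices n a b k).Finite := by
  refine (Set.Finite.pi' fun _ : Fin a =>
    Set.Finite.pi' fun _ : Fin b => (Finset.Icc 1 n).finite_toSet).subset ?_
  intro x hx i j
  exact hx.1 i j

theorem rankFiber_finite (n : ℕ) {a b k : ℕ} (e : Fin k → Fin a)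
    (γ : Fin k → {s // s ∉ Set.range e} → ℝ) : (rankFiber (b := b) n e γ).Finite := by
  refine (Set.Finite.pi' fun _ : Fin a =>
    Set.Finite.pi' fun _ : Fin b => (Finset.Icc 1 n).finite_toSet).subset ?_
  intro x hx i j
  exact hx.1 i j

theorem card_compl_range {a k : ℕ} {e : Fin k → Fin a} (he : Function.Injective e)
    [Fintype {s // s ∉ Set.range e}] : Fintype.card {s // s ∉ Set.range e} = a - k := by
  classical
  rw [Fintype.card_subtype_compl, Fintype.card_fin]
  congr 1
  have := Set.card_range_of_injective he
  rw [Fintype.card_fin] at this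
  convert this

/-- A union bound over the row choice, the orders and the coefficients; both estimates are products
over `l`, so the sum over tuples `q` factors. -/
theorem ncard_rankMatrices_le_sum (n a b k : ℕ) :
    ((rankMatrices n a b k).ncard : ℝ) ≤ a ^ k *
      ((((k + 1) * n + 1) ^ k : ℕ) : ℝ) ^ b *
      ∏ l : Fin k, ∑ q ∈ Finset.Icc 1 (((k + 1) * n + 1) ^ k),
        (3 : ℝ) ^ (a - k) * ((q : ℝ) ^ ((a - k) + (k - 1 - (l : ℕ))) / (q : ℝ) ^ b) := by
  classical
  set M := ((k + 1) * n + 1) ^ k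
  let P : Finset (Fin k → ℕ) := Fintype.piFinset fun _ => Finset.Icc 1 M
  have hP : ∀ q ∈ P, ∀ l, 0 < q l := fun q hq l =>
    (Finset.mem_Icc.1 (Fintype.mem_piFinset.1 hq l)).1
  let Good : (e : Fin k → Fin a) → (Fin k → ℕ) →
      Set (Fin k → {s // s ∉ Set.range e} → ℝ) := fun e q =>
    {γ | Set.InjOn (fun x : Fin k → ℕ => torusHom γ fun l => (x l : ℤ)) {x | ∀ l, x l < q l}}
  let Γ : (e : Fin k → Fin a) → (Fin k → ℕ) →
      Finset (Fin k → {s // s ∉ Set.range e} → ℝ) := fun e q =>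
    -- Finiteness is available only for positive orders; the empty default is never used, since `P`
    -- contains only such `q`.
    if h : ∀ l, 0 < q l then
      ((relativeOrderTuples_card (S := {s // s ∉ Set.range e}) q h).1.subset
        (Set.inter_subset_left (t := Good e q))).toFinset else ∅
  have hΓ : ∀ e q, (∀ l, 0 < q l) → ∀ γ, γ ∈ Γ e q ↔
      γ ∈ relativeOrderTuples {s // s ∉ Set.range e} q ∧ γ ∈ Good e q := by
    intro e q hq γ
    simp only [Γ, dif_pos hq, Set.Finite.mem_toFinset]
    rfl
  let E : Finset (Fin k → Fin a) := Finset.univ.filter Function.Injective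
  have hsub : (rankMatrices_finite n a b k).toFinset ⊆ E.biUnion fun e => P.biUnion fun q =>
      (Γ e q).biUnion fun γ => (rankFiber_finite (b := b) n e γ).toFinset := by
    intro A hA
    obtain ⟨e, he, q, hq, γ, hγ, hAf, hinj⟩ :=
      exists_mem_rankFiber ((Set.Finite.mem_toFinset _).1 hA)
    simp only [Finset.mem_biUnion]
    refine ⟨e, by simpa [E] using he, q, ?_, γ, (hΓ e q hq γ).2 ⟨hγ, hinj⟩,
      (Set.Finite.mem_toFinset _).2 hAf⟩
    simp only [P, Fintype.mem_piFinset, Finset.mem_Icc]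
    refine fun l => ⟨hq l, ?_⟩
    exact (Finset.single_le_prod' (f := q) (fun i _ => hq i) (Finset.mem_univ l)).trans
      (rankFiber_bound e γ q hinj ⟨A, hAf⟩).1
  have hterm : ∀ e ∈ E, ∀ q ∈ P, ∀ γ ∈ Γ e q,
      ((rankFiber_finite (b := b) n e γ).toFinset.card : ℝ) ≤ (M : ℝ) ^ b / (∏ l, (q l : ℝ)) ^ b := by
    intro e _ q hq γ hγ
    have hpos : (0 : ℝ) < ∏ l, (q l : ℝ) :=
      Finset.prod_pos fun l _ => by exact_mod_cast hP q hq l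
    rw [← Set.ncard_eq_toFinset_card _ (rankFiber_finite (b := b) n e γ)]
    rcases (rankFiber (b := b) n e γ).eq_empty_or_nonempty with h | h
    · rw [h, Set.ncard_empty, Nat.cast_zero]
      positivity
    · rw [le_div_iff₀ (by positivity)]
      exact_mod_cast (rankFiber_bound e γ q ((hΓ e q (hP q hq) γ).1 hγ).2 h).2
  have hΓcard : ∀ e ∈ E, ∀ q ∈ P, ((Γ e q).card : ℝ) ≤
      ∏ l : Fin k, (3 : ℝ) ^ (a - k) * (q l : ℝ) ^ ((a - k) + (k - 1 - (l : ℕ))) := by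
    intro e he q hq
    have h1 := relativeOrderTuples_card (S := {s // s ∉ Set.range e}) q (hP q hq)
    rw [card_compl_range (by simpa [E] using he)] at h1
    have h2 : (Γ e q).card ≤ (relativeOrderTuples {s // s ∉ Set.range e} q).ncard := by
      rw [← Set.ncard_coe_finset]
      exact Set.ncard_le_ncard (fun γ hγ => ((hΓ e q (hP q hq) γ).1 hγ).1) h1.1
    exact_mod_cast h2.trans h1.2
  have hqsum : ∀ e ∈ E, ∀ q ∈ P, (((Γ e q).biUnion fun γ =>
      (rankFiber_finite (b := b) n e γ).toFinset).card : ℝ) ≤ (M : ℝ) ^ b * ∏ l : Fin k,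
        (3 : ℝ) ^ (a - k) * ((q l : ℝ) ^ ((a - k) + (k - 1 - (l : ℕ))) / (q l : ℝ) ^ b) := by
    intro e he q hq
    calc (((Γ e q).biUnion fun γ => (rankFiber_finite (b := b) n e γ).toFinset).card : ℝ)
        ≤ ∑ γ ∈ Γ e q, ((rankFiber_finite (b := b) n e γ).toFinset.card : ℝ) := by
          exact_mod_cast Finset.card_biUnion_le
      _ ≤ ∑ γ ∈ Γ e q, (M : ℝ) ^ b / (∏ l, (q l : ℝ)) ^ b :=
          Finset.sum_le_sum (hterm e he q hq)
      _ = (Γ e q).card * ((M : ℝ) ^ b / (∏ l, (q l : ℝ)) ^ b) := by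
          rw [Finset.sum_const, nsmul_eq_mul]
      _ ≤ (∏ l : Fin k, (3 : ℝ) ^ (a - k) * (q l : ℝ) ^ ((a - k) + (k - 1 - (l : ℕ)))) *
            ((M : ℝ) ^ b / (∏ l, (q l : ℝ)) ^ b) := by
          refine mul_le_mul_of_nonneg_right (hΓcard e he q hq) (by positivity)
      _ = _ := by
          simp only [← mul_div_assoc, Finset.prod_div_distrib, Finset.prod_pow]
          ring
  have hE : (E.card : ℝ) ≤ (a : ℝ) ^ k := by
    have : E.card ≤ a ^ k := (Finset.card_le_univ _).trans (by simp)
    exact_mod_cast this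
  rw [Set.ncard_eq_toFinset_card _ (rankMatrices_finite n a b k)]
  calc ((rankMatrices_finite n a b k).toFinset.card : ℝ)
      ≤ ∑ e ∈ E, ∑ q ∈ P, (((Γ e q).biUnion fun γ =>
          (rankFiber_finite (b := b) n e γ).toFinset).card : ℝ) := by
        have := (Finset.card_le_card hsub).trans (Finset.card_biUnion_le.trans
          (Finset.sum_le_sum fun e _ => Finset.card_biUnion_le))
        exact_mod_cast this
    _ ≤ ∑ e ∈ E, ∑ q ∈ P, (M : ℝ) ^ b * ∏ l : Fin k,
        (3 : ℝ) ^ (a - k) * ((q l : ℝ) ^ ((a - k) + (k - 1 - (l : ℕ))) / (q l : ℝ) ^ b) :=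
        Finset.sum_le_sum fun e he => Finset.sum_le_sum fun q hq => hqsum e he q hq
    _ = E.card * ((M : ℝ) ^ b * ∏ l : Fin k, ∑ q ∈ Finset.Icc 1 M,
        (3 : ℝ) ^ (a - k) * ((q : ℝ) ^ ((a - k) + (k - 1 - (l : ℕ))) / (q : ℝ) ^ b)) := by
        rw [Finset.sum_const, nsmul_eq_mul, ← Finset.mul_sum, Finset.prod_univ_sum]
    _ ≤ _ := by
        rw [mul_assoc]
        refine mul_le_mul_of_nonneg_right hE (by positivity)

/-- The net exponent `a - 1 - l - b` equals `-1` only when `l = 0` and `a = b`; otherwise it is at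
most `-2` and the sum is bounded. -/
theorem sum_pow_div_pow_le {a b k : ℕ} (hab : a ≤ b) (hka : k ≤ a) (l : Fin k) (M : ℕ) :
    ∑ q ∈ Finset.Icc 1 M, ((q : ℝ) ^ ((a - k) + (k - 1 - (l : ℕ))) / (q : ℝ) ^ b) ≤
      2 * if (l : ℕ) = 0 then (if a = b then 1 + Real.log M else 1) else 1 := by
  have hl := l.2
  have hlog : 0 ≤ Real.log M := Real.log_natCast_nonneg M
  by_cases h : (l : ℕ) = 0 ∧ a = b
  · rw [if_pos h.1, if_pos h.2]
    have h1 : ∑ q ∈ Finset.Icc 1 M, ((q : ℝ) ^ ((a - k) + (k - 1 - (l : ℕ))) / (q : ℝ) ^ b) =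
        ∑ q ∈ Finset.Icc 1 M, (1 : ℝ) / q := by
      refine Finset.sum_congr rfl fun q hq => ?_
      have hq0 : (0 : ℝ) < q := by exact_mod_cast (Finset.mem_Icc.1 hq).1
      obtain ⟨c, hc⟩ : ∃ c, b = c + 1 := ⟨b - 1, by omega⟩
      have h2 : (a - k) + (k - 1 - (l : ℕ)) = c := by omega
      rw [h2, hc, pow_succ]
      field_simp
    rw [h1]
    have := sum_Icc_inv_le M
    linarith
  · have h1 : ∑ q ∈ Finset.Icc 1 M, ((q : ℝ) ^ ((a - k) + (k - 1 - (l : ℕ))) / (q : ℝ) ^ b) ≤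
        ∑ q ∈ Finset.Icc 1 M, (1 : ℝ) / (q : ℝ) ^ 2 := by
      refine Finset.sum_le_sum fun q hq => ?_
      have hq1 : (1 : ℝ) ≤ q := by exact_mod_cast (Finset.mem_Icc.1 hq).1
      rw [div_le_div_iff₀ (by positivity) (by positivity), one_mul, ← pow_add]
      exact pow_le_pow_right₀ hq1 (by omega)
    refine (h1.trans (sum_Icc_inv_sq_le M)).trans ?_
    split_ifs <;> linarith

theorem ncard_rankMatrices_le {a b : ℕ} (k : ℕ) (hab : a ≤ b) (hka : k ≤ a) :
    ∃ C : ℝ, 0 < C ∧ ∀ n : ℕ, 3 ≤ n → ((rankMatrices n a b k).ncard : ℝ) ≤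
      C * ((n : ℝ) ^ (k * b) * if a = b then Real.log n else 1) := by
  refine ⟨((a : ℝ) + 1) ^ k * ((k : ℝ) + 2) ^ (k * b) * (3 ^ (a - k) * 2) ^ k *
    (1 + k * (Real.log (k + 2) + 1)), ?_, fun n hn => ?_⟩
  · have : 0 < Real.log ((k : ℝ) + 2) := Real.log_pos (by have := k.cast_nonneg (α := ℝ); linarith)
    positivity
  have hlogk : 0 < Real.log ((k : ℝ) + 2) :=
    Real.log_pos (by have := k.cast_nonneg (α := ℝ); linarith)
  have hn0 : (0 : ℝ) < n := by exact_mod_cast (by omega : 0 < n)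
  have hn3 : (3 : ℝ) ≤ n := by exact_mod_cast hn
  -- Since `n ≥ 3 > e`, additive constants can be absorbed into `log n`.
  have hlogn : 1 ≤ Real.log n := by
    rw [Real.le_log_iff_exp_le hn0]
    exact (Real.exp_one_lt_d9.le.trans (by norm_num)).trans hn3
  refine (ncard_rankMatrices_le_sum n a b k).trans ?_
  set M := ((k + 1) * n + 1) ^ k with hM
  have hM0 : 0 < M := by positivity
  have hMle : (M : ℝ) ≤ (((k : ℝ) + 2) * n) ^ k := by
    rw [hM]; push_cast
    exact pow_le_pow_left₀ (by positivity) (by nlinarith) _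
  have hlogM : Real.log M ≤ k * (Real.log (k + 2) + Real.log n) := by
    refine (Real.log_le_log (by exact_mod_cast hM0) hMle).trans ?_
    rw [Real.log_pow, Real.log_mul (by positivity) hn0.ne']
  have hlogM0 : 0 ≤ Real.log M := Real.log_natCast_nonneg M
  set W : ℝ := if a = b then 1 + Real.log M else 1 with hW
  have hW1 : 1 ≤ W := by rw [hW]; split_ifs <;> linarith
  have hprod : ∏ l : Fin k, ∑ q ∈ Finset.Icc 1 M,
        (3 : ℝ) ^ (a - k) * ((q : ℝ) ^ ((a - k) + (k - 1 - (l : ℕ))) / (q : ℝ) ^ b) ≤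
      (3 ^ (a - k) * 2) ^ k * W := by
    calc _ ≤ ∏ l : Fin k, ((3 : ℝ) ^ (a - k) * 2) * (if (l : ℕ) = 0 then W else 1) := by
          refine Finset.prod_le_prod (fun l _ => Finset.sum_nonneg fun q _ => by positivity)
            fun l _ => ?_
          rw [← Finset.mul_sum, mul_assoc]
          exact mul_le_mul_of_nonneg_left (sum_pow_div_pow_le hab hka l M) (by positivity)
      _ = (3 ^ (a - k) * 2) ^ k * ∏ l : Fin k, (if (l : ℕ) = 0 then W else 1) := by
          rw [Finset.prod_mul_distrib, Finset.prod_const, Finset.card_univ, Fintype.card_fin]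
      _ ≤ _ := by
          refine mul_le_mul_of_nonneg_left ?_ (by positivity)
          cases k with
          | zero => simpa using hW1
          | succ k => rw [Fin.prod_univ_succ]; simp
  have hWle : W ≤ (1 + k * (Real.log (k + 2) + 1)) * if a = b then Real.log n else 1 := by
    have hk0 : (0 : ℝ) ≤ k := Nat.cast_nonneg k
    rw [hW]
    split_ifs
    · have : k * Real.log ((k : ℝ) + 2) ≤ k * Real.log ((k : ℝ) + 2) * Real.log n :=
        le_mul_of_one_le_right (by positivity) hlogn
      nlinarith
    · have : 0 ≤ k * (Real.log ((k : ℝ) + 2) + 1) := by positivity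
      linarith
  have hMb : (M : ℝ) ^ b ≤ ((k : ℝ) + 2) ^ (k * b) * (n : ℝ) ^ (k * b) := by
    rw [← mul_pow, pow_mul]
    exact pow_le_pow_left₀ (by positivity) hMle _
  have ha : (a : ℝ) ^ k ≤ ((a : ℝ) + 1) ^ k := pow_le_pow_left₀ (by positivity) (by linarith) _
  have hw0 : 0 ≤ W := by linarith
  calc _ ≤ ((a : ℝ) + 1) ^ k * (((k : ℝ) + 2) ^ (k * b) * (n : ℝ) ^ (k * b)) *
        ((3 ^ (a - k) * 2) ^ k * ((1 + k * (Real.log (k + 2) + 1)) *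
          if a = b then Real.log n else 1)) := by
        refine mul_le_mul (mul_le_mul ha hMb (by positivity) (by positivity))
          (hprod.trans (mul_le_mul_of_nonneg_left hWle (by positivity)))
          (Finset.prod_nonneg fun l _ => Finset.sum_nonneg fun q _ => by positivity)
          (by positivity)
    _ = _ := by ring

/-! ### Rank at most `k`, transposition and the power lower bound -/

/-- Matrices with entries in `{1, …, n}` whose rank is at most `k`. -/
def lowRankMatrices (n a b k : ℕ) : Set (Fin a → Fin b → ℕ) :=
  {A | (∀ i j, A i j ∈ Finset.Icc 1 n) ∧ (Matrix.of fun i j => (A i j : ℝ)).rank ≤ k}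

theorem lowRankMatrices_finite (n a b k : ℕ) : (lowRankMatrices n a b k).Finite := by
  refine (Set.Finite.pi' fun _ : Fin a =>
    Set.Finite.pi' fun _ : Fin b => (Finset.Icc 1 n).finite_toSet).subset ?_
  intro x hx i j
  exact hx.1 i j

theorem linearCount_eq_ncard_lowRankMatrices {d k : ℕ} (n r : ℕ) (hk : k ≤ d) :
    linearCount n d k r = (lowRankMatrices n r d k).ncard := by
  rw [linearCount, linearTuples_eq_rank_le n d k r hk]
  congr 1
  ext x
  refine and_congr_right fun _ => ?_
  rw [← Matrix.rank_transpose (Matrix.of fun (i : Fin r) (j : Fin d) => (x i j : ℝ))]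
  rfl

theorem ncard_lowRankMatrices_comm (n a b k : ℕ) :
    (lowRankMatrices n a b k).ncard = (lowRankMatrices n b a k).ncard := by
  have key : ∀ a b, (lowRankMatrices n a b k).ncard ≤ (lowRankMatrices n b a k).ncard := by
    intro a b
    refine Set.ncard_le_ncard_of_injOn (fun A j i => A i j) ?_ ?_ (lowRankMatrices_finite n b a k)
    · rintro A ⟨h1, h2⟩
      refine ⟨fun i j => h1 j i, ?_⟩
      rw [← Matrix.rank_transpose] at h2
      exact h2
    · intro A _ B _ h
      funext i j
      exact congrFun (congrFun h j) i
  exact le_antisymm (key a b) (key b a)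

theorem ncard_lowRankMatrices_le {a b k : ℕ} (hab : a ≤ b) (hka : k ≤ a) :
    ∃ C : ℝ, 0 < C ∧ ∀ n : ℕ, 3 ≤ n → ((lowRankMatrices n a b k).ncard : ℝ) ≤
      C * ((n : ℝ) ^ (k * b) * if a = b then Real.log n else 1) := by
  classical
  have h : ∀ j, ∃ C : ℝ, 0 < C ∧ (j ≤ a → ∀ n : ℕ, 3 ≤ n →
      ((rankMatrices n a b j).ncard : ℝ) ≤
        C * ((n : ℝ) ^ (j * b) * if a = b then Real.log n else 1)) := by
    intro j
    by_cases hj : j ≤ a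
    · obtain ⟨C, h0, h1⟩ := ncard_rankMatrices_le j hab hj
      exact ⟨C, h0, fun _ => h1⟩
    · exact ⟨1, one_pos, fun h => absurd h hj⟩
  choose C hC0 hC using h
  refine ⟨∑ j ∈ Finset.range (k + 1), C j,
    Finset.sum_pos (fun j _ => hC0 j) ⟨0, by simp⟩, fun n hn => ?_⟩
  have hn1 : (1 : ℝ) ≤ n := by exact_mod_cast (by omega : 1 ≤ n)
  have hsub : (lowRankMatrices_finite n a b k).toFinset ⊆ (Finset.range (k + 1)).biUnion fun j =>
      (rankMatrices_finite n a b j).toFinset := by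
    intro A hA
    obtain ⟨h1, h2⟩ := (Set.Finite.mem_toFinset _).1 hA
    exact Finset.mem_biUnion.2 ⟨_, Finset.mem_range.2 (Nat.lt_succ_of_le h2),
      (Set.Finite.mem_toFinset _).2 ⟨h1, rfl⟩⟩
  rw [Set.ncard_eq_toFinset_card _ (lowRankMatrices_finite n a b k), Finset.sum_mul]
  calc ((lowRankMatrices_finite n a b k).toFinset.card : ℝ)
      ≤ ∑ j ∈ Finset.range (k + 1), ((rankMatrices_finite n a b j).toFinset.card : ℝ) := by
        exact_mod_cast (Finset.card_le_card hsub).trans Finset.card_biUnion_le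
    _ ≤ _ := by
        refine Finset.sum_le_sum fun j hj => ?_
        have hjk : j ≤ k := Nat.lt_succ_iff.1 (Finset.mem_range.1 hj)
        rw [← Set.ncard_eq_toFinset_card _ (rankMatrices_finite n a b j)]
        refine (hC j (hjk.trans hka) n hn).trans ?_
        refine mul_le_mul_of_nonneg_left ?_ (hC0 j).le
        refine mul_le_mul_of_nonneg_right
          (pow_le_pow_right₀ hn1 (Nat.mul_le_mul_right _ hjk)) ?_
        split_ifs
        · exact Real.log_natCast_nonneg n
        · exact zero_le_one

/-- Choose the first `k` rows freely and repeat the last of them in all remaining positions. -/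
theorem pow_le_ncard_lowRankMatrices (n b : ℕ) {a k : ℕ} (hk : 0 < k) (hka : k ≤ a) :
    n ^ (k * b) ≤ (lowRankMatrices n a b k).ncard := by
  let g : Fin a → Fin k := fun i => ⟨min i (k - 1), by omega⟩
  have hg : ∀ l : Fin k, g ⟨l, by omega⟩ = l := fun l => by
    ext
    simp only [g]
    omega
  have hcard : (Fintype.piFinset fun _ : Fin k => Fintype.piFinset fun _ : Fin b =>
      Finset.Icc 1 n).card = n ^ (k * b) := by
    simp only [Fintype.card_piFinset, Nat.card_Icc, Nat.add_sub_cancel, Finset.prod_const,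
      Finset.card_univ, Fintype.card_fin]
    rw [← pow_mul, mul_comm]
  rw [← hcard, ← Set.ncard_coe_finset]
  refine Set.ncard_le_ncard_of_injOn (fun X i j => X (g i) j) ?_ ?_ (lowRankMatrices_finite n a b k)
  · intro X hX
    simp only [Finset.mem_coe, Fintype.mem_piFinset] at hX
    refine ⟨fun i j => hX (g i) j, ?_⟩
    have h : (Matrix.of fun (i : Fin a) (j : Fin b) => (X (g i) j : ℝ)) =
        (Matrix.of fun i l => if g i = l then (1 : ℝ) else 0) *
          Matrix.of fun (l : Fin k) (j : Fin b) => (X l j : ℝ) := by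
      ext i j
      simp [Matrix.mul_apply]
    rw [h]
    exact (Matrix.rank_mul_le_left _ _).trans (Matrix.rank_le_width _)
  · intro X _ Y _ h
    funext l j
    have := congrFun (congrFun h ⟨l, by omega⟩) j
    simpa only [hg] using this

/-! ### A logarithmic totient sum -/

/-- Write `1 / q = ∑_{e ∣ q} φ(e) / q^2`, exchange the sums and put `q = e g`; the sum over `g` of
`1 / g^2` costs the factor 2. -/
theorem sum_inv_le_two_mul_sum_totient (M : ℕ) :
    ∑ q ∈ Finset.Icc 1 M, (1 : ℝ) / q ≤
      2 * ∑ q ∈ Finset.Icc 1 M, (Nat.totient q : ℝ) / (q : ℝ) ^ 2 := by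
  have h1 : ∀ q ∈ Finset.Icc 1 M, (1 : ℝ) / q =
      ∑ e ∈ Finset.Icc 1 M, if e ∣ q then (Nat.totient e : ℝ) / (q : ℝ) ^ 2 else 0 := by
    intro q hq
    obtain ⟨hq1, hqM⟩ := Finset.mem_Icc.1 hq
    have hq0 : (q : ℝ) ≠ 0 := by exact_mod_cast (by omega : q ≠ 0)
    have hdiv : (Finset.Icc 1 M).filter (· ∣ q) = q.divisors := by
      ext e
      simp only [Finset.mem_filter, Finset.mem_Icc, Nat.mem_divisors]
      constructor
      · rintro ⟨_, h⟩
        exact ⟨h, by omega⟩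
      · rintro ⟨h, _⟩
        exact ⟨⟨Nat.pos_of_dvd_of_pos h hq1, (Nat.le_of_dvd hq1 h).trans hqM⟩, h⟩
    rw [← Finset.sum_filter, hdiv, ← Finset.sum_div]
    have h : ∑ e ∈ q.divisors, (Nat.totient e : ℝ) = q := by exact_mod_cast Nat.sum_totient q
    rw [h]
    field_simp
  rw [Finset.sum_congr rfl h1, Finset.sum_comm, Finset.mul_sum]
  refine Finset.sum_le_sum fun e he => ?_
  have he0 : 0 < e := (Finset.mem_Icc.1 he).1
  rw [← Finset.sum_filter]
  calc ∑ q ∈ (Finset.Icc 1 M).filter (e ∣ ·), (Nat.totient e : ℝ) / (q : ℝ) ^ 2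
      ≤ ∑ q ∈ (Finset.Icc 1 M).image (e * ·), (Nat.totient e : ℝ) / (q : ℝ) ^ 2 := by
        refine Finset.sum_le_sum_of_subset_of_nonneg ?_ fun _ _ _ => by positivity
        intro q hq
        obtain ⟨hq1, g, rfl⟩ := Finset.mem_filter.1 hq
        obtain ⟨h2, h3⟩ := Finset.mem_Icc.1 hq1
        refine Finset.mem_image.2 ⟨g, Finset.mem_Icc.2 ⟨Nat.pos_of_mul_pos_left h2, ?_⟩, rfl⟩
        exact (Nat.le_mul_of_pos_left g he0).trans h3
    _ = (Nat.totient e : ℝ) / (e : ℝ) ^ 2 * ∑ g ∈ Finset.Icc 1 M, (1 : ℝ) / (g : ℝ) ^ 2 := by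
        rw [Finset.sum_image fun x _ y _ h => Nat.eq_of_mul_eq_mul_left he0 h, Finset.mul_sum]
        refine Finset.sum_congr rfl fun g _ => ?_
        push_cast
        rw [mul_pow, div_mul_div_comm, mul_one]
    _ ≤ (Nat.totient e : ℝ) / (e : ℝ) ^ 2 * 2 :=
        mul_le_mul_of_nonneg_left (sum_Icc_inv_sq_le M) (by positivity)
    _ = _ := mul_comm _ _

theorem log_le_sum_totient (M : ℕ) :
    Real.log (M + 1) / 2 ≤ ∑ q ∈ Finset.Icc 1 M, (Nat.totient q : ℝ) / (q : ℝ) ^ 2 := by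
  have h := log_add_one_le_harmonic M
  rw [harmonic_eq_sum_Icc] at h
  push_cast at h
  have h2 := sum_inv_le_two_mul_sum_totient M
  simp only [one_div] at h2
  linarith

/-! ### Square case: many matrices from proportional numerators -/

theorem exists_mul_modEq_of_coprime {u q : ℕ} (hq : 0 < q) (hu : q.Coprime u) (β N : ℕ) :
    ∃ c, β < c ∧ c ≤ β + q ∧ u * c ≡ N [MOD q] := by
  have : NeZero q := ⟨hq.ne'⟩
  let r : ZMod q := (u : ZMod q)⁻¹ * N - β - 1
  refine ⟨β + 1 + r.val, by omega, by have := r.val_lt; omega, ?_⟩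
  rw [← ZMod.natCast_eq_natCast_iff]
  push_cast
  rw [ZMod.natCast_zmod_val]
  have h := ZMod.coe_mul_inv_eq_one u hu.symm
  linear_combination (N : ZMod q) * h

/-- Points of a box with side `M` that satisfy the congruence `∑ u_l x_l ≡ 0` modulo `q`. -/
def congruencePoints {k : ℕ} (M q : ℕ) (u β : Fin k → ℕ) : Finset (Fin k → ℕ) :=
  (Fintype.piFinset fun l => Finset.Ioc (β l) (β l + M)).filter fun x => q ∣ ∑ l, u l * x l

/-- All coordinates but the zeroth are free; as `u 0` is a unit modulo `q`, the zeroth is confined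
to one residue class, which has at least `M / q` members in its interval. -/
theorem le_card_congruencePoints {κ : ℕ} (M : ℕ) {q : ℕ} (hq : 0 < q) (u β : Fin (κ + 1) → ℕ)
    (hu : q.Coprime (u 0)) : M ^ κ * (M / q) ≤ (congruencePoints M q u β).card := by
  -- The factor `q - 1` plays the role of `-1` modulo `q` within `ℕ`.
  have hex : ∀ y : Fin κ → ℕ, ∃ c, β 0 < c ∧ c ≤ β 0 + q ∧
      u 0 * c ≡ (q - 1) * ∑ l : Fin κ, u l.succ * y l [MOD q] := fun y =>
    exists_mul_modEq_of_coprime hq hu _ _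
  choose c hc1 hc2 hc3 using hex
  have hcard : ((Fintype.piFinset fun l : Fin κ => Finset.Ioc (β l.succ) (β l.succ + M)) ×ˢ
      Finset.range (M / q)).card = M ^ κ * (M / q) := by
    simp
  rw [← hcard]
  refine Finset.card_le_card_of_injOn
    (fun p => (Fin.cons (c p.1 + q * p.2) p.1 : Fin (κ + 1) → ℕ)) ?_ ?_
  · rintro ⟨y, s⟩ hp
    obtain ⟨hy, hs⟩ := Finset.mem_product.1 hp
    simp only [Fintype.mem_piFinset, Finset.mem_Ioc, Finset.mem_range] at hy hs
    simp only [congruencePoints, Finset.mem_coe, Finset.mem_filter, Fintype.mem_piFinset,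
      Finset.mem_Ioc]
    constructor
    · intro l
      refine Fin.cases ?_ (fun l => ?_) l
      · rw [Fin.cons_zero]
        have h1 := hc1 y
        have h2 := hc2 y
        have h3 : q * (s + 1) ≤ M := (Nat.mul_le_mul_left q hs).trans (Nat.mul_div_le M q)
        rw [Nat.mul_succ] at h3
        constructor <;> omega
      · rw [Fin.cons_succ]
        exact hy l
    · rw [Fin.sum_univ_succ]
      simp only [Fin.cons_zero, Fin.cons_succ]
      rw [← Nat.modEq_zero_iff_dvd]
      have h1 := (hc3 y).add_right (∑ l : Fin κ, u l.succ * y l)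
      have h2 : (q - 1) * ∑ l : Fin κ, u l.succ * y l + ∑ l : Fin κ, u l.succ * y l =
          q * ∑ l : Fin κ, u l.succ * y l := by
        obtain ⟨p, rfl⟩ : ∃ p, q = p + 1 := ⟨q - 1, by omega⟩
        rw [Nat.add_sub_cancel]; ring
      rw [h2] at h1
      have h3 : u 0 * (c y + q * s) + ∑ l : Fin κ, u l.succ * y l =
          (u 0 * c y + ∑ l : Fin κ, u l.succ * y l) + q * (u 0 * s) := by ring
      rw [h3]
      have h4 := h1.add ((Nat.modEq_zero_iff_dvd.2 (dvd_mul_right q (u 0 * s))))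
      exact h4.trans (by rw [add_zero]; exact Nat.modEq_zero_iff_dvd.2 (dvd_mul_right _ _))
  · rintro ⟨y, s⟩ _ ⟨y', s'⟩ _ h
    obtain ⟨h1, rfl⟩ := Fin.cons_inj.1 h
    have : q * s = q * s' := by simpa using h1
    rw [Nat.eq_of_mul_eq_mul_left hq this]

/-- Numerators `C` of coefficient matrices with denominator `q` all of whose rows are multiples
of the first one modulo `q`. -/
def proportionalNumerators (κ m q : ℕ) : Finset (Fin (m + 1) → Fin (κ + 1) → ℕ) :=
  (Fintype.piFinset fun _ => Fintype.piFinset fun _ => Finset.Icc 1 q).filter fun C =>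
    q.Coprime (C 0 0) ∧ ∀ s l, C 0 0 * C s l ≡ C s 0 * C 0 l [MOD q]

/-- The corner is a unit modulo `q`, the rest of the first row and first column is free, and
proportionality then determines every other entry. -/
theorem le_card_proportionalNumerators (κ m : ℕ) {q : ℕ} (hq : 0 < q) :
    q.totient * q ^ (κ + m) ≤ (proportionalNumerators κ m q).card := by
  have hex : ∀ u₀ N : ℕ, ∃ c, q.Coprime u₀ → 0 < c ∧ c ≤ q ∧ u₀ * c ≡ N [MOD q] := by
    intro u₀ N
    by_cases h : q.Coprime u₀
    · obtain ⟨c, h1, h2, h3⟩ := exists_mul_modEq_of_coprime hq h 0 N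
      exact ⟨c, fun _ => ⟨h1, by omega, h3⟩⟩
    · exact ⟨0, fun h' => absurd h' h⟩
  choose c hc using hex
  have hcard : (((Finset.Ico 1 (1 + q)).filter fun x => q.Coprime x) ×ˢ
      ((Fintype.piFinset fun _ : Fin κ => Finset.Icc 1 q) ×ˢ
        (Fintype.piFinset fun _ : Fin m => Finset.Icc 1 q))).card = q.totient * q ^ (κ + m) := by
    rw [Finset.card_product, Finset.card_product, Nat.filter_coprime_Ico_eq_totient]
    simp [pow_add]
  rw [← hcard]
  refine Finset.card_le_card_of_injOn (fun p =>
    (Fin.cons (Fin.cons p.1 p.2.1) fun s => Fin.cons (p.2.2 s) fun l => c p.1 (p.2.2 s * p.2.1 l) :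
      Fin (m + 1) → Fin (κ + 1) → ℕ)) ?_ ?_
  · rintro ⟨u₀, u, w⟩ hp
    simp only [Finset.mem_coe, Finset.mem_product, Finset.mem_filter, Finset.mem_Ico,
      Fintype.mem_piFinset, Finset.mem_Icc] at hp
    obtain ⟨⟨⟨h1, h2⟩, h3⟩, hu, hw⟩ := hp
    simp only [proportionalNumerators, Finset.mem_coe, Finset.mem_filter, Fintype.mem_piFinset,
      Finset.mem_Icc, Fin.cons_zero]
    refine ⟨fun s => ?_, h3, fun s => ?_⟩
    · refine Fin.cases (fun l => ?_) (fun s l => ?_) s <;> refine Fin.cases ?_ (fun l => ?_) l <;>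
        simp only [Fin.cons_zero, Fin.cons_succ]
      · omega
      · exact hu l
      · exact hw s
      · exact ⟨(hc u₀ (w s * u l) h3).1, (hc u₀ (w s * u l) h3).2.1⟩
    · refine Fin.cases (fun l => Nat.ModEq.refl _) (fun s l => ?_) s
      refine Fin.cases ?_ (fun l => ?_) l <;> simp only [Fin.cons_zero, Fin.cons_succ]
      · rw [mul_comm]
      · exact (hc u₀ (w s * u l) h3).2.2
  · rintro ⟨u₀, u, w⟩ _ ⟨u₀', u', w'⟩ _ h
    obtain ⟨h1, h2⟩ := Fin.cons_inj.1 h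
    obtain ⟨rfl, rfl⟩ := Fin.cons_inj.1 h1
    have : w = w' := funext fun s => (Fin.cons_inj.1 (congrFun h2 s)).1
    rw [this]

/-- Offsets of the boxes which make the leading square block of a matrix diagonally dominant. -/
def dominantOffset (κ m M : ℕ) (j : Fin (κ + 1 + (m + 1))) (l : Fin (κ + 1)) : ℕ :=
  if j = Fin.castAdd (m + 1) l then (κ + 1) * M else 0

/-- The matrix with top rows given by the columns `X` and bottom rows `(C / q) X`. -/
def extendByNumerators {κ m b : ℕ} (q : ℕ) (C : Fin (m + 1) → Fin (κ + 1) → ℕ)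
    (X : Fin b → Fin (κ + 1) → ℕ) : Fin (κ + 1 + (m + 1)) → Fin b → ℕ :=
  fun i j => Fin.append (fun l => X j l) (fun s => (∑ l, C s l * X j l) / q) i

/-- Proportionality and the unit `C 0 0` transfer the congruence for row 0 to every row, so a column
pays a factor `q` only once. -/
theorem dvd_sum_of_mem {κ m M q : ℕ} {C : Fin (m + 1) → Fin (κ + 1) → ℕ}
    (hC : C ∈ proportionalNumerators κ m q) {β x : Fin (κ + 1) → ℕ}
    (hx : x ∈ congruencePoints M q (C 0) β) (s : Fin (m + 1)) : q ∣ ∑ l, C s l * x l := by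
  obtain ⟨_, hcop, hprop⟩ := Finset.mem_filter.1 hC
  have h1 := (Finset.mem_filter.1 hx).2
  refine hcop.dvd_of_dvd_mul_left (Nat.modEq_zero_iff_dvd.1 ?_)
  have h2 : C 0 0 * ∑ l, C s l * x l ≡ C s 0 * ∑ l, C 0 l * x l [MOD q] := by
    simp only [Finset.mul_sum, ← mul_assoc]
    rw [← ZMod.natCast_eq_natCast_iff]
    push_cast
    refine Finset.sum_congr rfl fun l _ => ?_
    have := (ZMod.natCast_eq_natCast_iff _ _ _).2 (hprop s l)
    push_cast at this
    rw [this]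
  exact h2.trans (Nat.modEq_zero_iff_dvd.2 (h1.mul_left _))

/-- Each column sums to at most `2 (κ + 1) M ≤ n`, since at most one coordinate has a nonzero
offset. As `C ≤ q`, dividing by `q` keeps the new entries at most that sum. The rank bound comes
from factoring through `κ + 1` rows. -/
theorem extendByNumerators_mem {κ m M n q b : ℕ} (hq : 0 < q) (hM : 2 * (κ + 1) * M ≤ n)
    {C : Fin (m + 1) → Fin (κ + 1) → ℕ} (hC : C ∈ proportionalNumerators κ m q)
    (π : Fin b → Fin (κ + 1 + (m + 1))) {X : Fin b → Fin (κ + 1) → ℕ}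
    (hX : ∀ j, X j ∈ congruencePoints M q (C 0) (dominantOffset κ m M (π j))) :
    extendByNumerators q C X ∈ lowRankMatrices n (κ + 1 + (m + 1)) b (κ + 1) := by
  have hdvd := fun s j => dvd_sum_of_mem hC (hX j) s
  have hCbox : ∀ s l, 1 ≤ C s l ∧ C s l ≤ q := fun s l => Finset.mem_Icc.1
    (Fintype.mem_piFinset.1 (Fintype.mem_piFinset.1 (Finset.mem_filter.1 hC).1 s) l)
  have hXbox : ∀ j l, dominantOffset κ m M (π j) l < X j l ∧
      X j l ≤ dominantOffset κ m M (π j) l + M := fun j l => Finset.mem_Ioc.1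
    (Fintype.mem_piFinset.1 (Finset.mem_filter.1 (hX j)).1 l)
  have hsum : ∀ j, ∑ l, X j l ≤ n := by
    intro j
    refine le_trans ?_ hM
    calc ∑ l, X j l ≤ ∑ l, (dominantOffset κ m M (π j) l + M) :=
          Finset.sum_le_sum fun l _ => (hXbox j l).2
      _ ≤ (κ + 1) * M + (κ + 1) * M := by
          rw [Finset.sum_add_distrib]
          refine Nat.add_le_add ?_ (by simp)
          by_cases h : ∃ l, π j = Fin.castAdd (m + 1) l
          · obtain ⟨l, hl⟩ := h
            rw [Finset.sum_eq_single l]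
            · simp [dominantOffset, hl]
            · intro l' _ hl'
              refine if_neg fun h => hl' ?_
              exact (Fin.castAdd_injective _ _ (hl.symm.trans h)).symm
            · simp
          · rw [Finset.sum_eq_zero]
            · exact Nat.zero_le _
            · exact fun l _ => if_neg fun h' => h ⟨l, h'⟩
      _ = 2 * (κ + 1) * M := by ring
  constructor
  · intro i j
    rw [Finset.mem_Icc]
    refine Fin.addCases (fun l => ?_) (fun s => ?_) i
    · simp only [extendByNumerators, Fin.append_left]
      exact ⟨Nat.lt_of_le_of_lt (Nat.zero_le _) (hXbox j l).1,
        (Finset.single_le_sum (fun _ _ => Nat.zero_le _) (Finset.mem_univ l)).trans (hsum j)⟩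
    · simp only [extendByNumerators, Fin.append_right]
      constructor
      · refine Nat.div_pos (Nat.le_of_dvd ?_ (hdvd s j)) hq
        exact Finset.sum_pos (fun l _ => Nat.mul_pos (hCbox s l).1
          (Nat.lt_of_le_of_lt (Nat.zero_le _) (hXbox j l).1)) ⟨0, Finset.mem_univ _⟩
      · refine Nat.div_le_of_le_mul ((Finset.sum_le_sum fun l _ =>
          Nat.mul_le_mul_right _ (hCbox s l).2).trans ?_)
        rw [← Finset.mul_sum]
        exact Nat.mul_le_mul_left _ (hsum j)
  · have h : (Matrix.of fun i j => (extendByNumerators q C X i j : ℝ)) =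
        (Matrix.of fun (i : Fin (κ + 1 + (m + 1))) (l : Fin (κ + 1)) =>
          (Fin.append (fun l' => if l' = l then (1 : ℝ) else 0) (fun s => (C s l : ℝ) / q) i)) *
          Matrix.of fun (l : Fin (κ + 1)) (j : Fin b) => (X j l : ℝ) := by
      ext i j
      rw [Matrix.mul_apply]
      refine Fin.addCases (fun l => ?_) (fun s => ?_) i
      · simp [extendByNumerators]
      · simp only [extendByNumerators, Matrix.of_apply, Fin.append_right]
        rw [Nat.cast_div (hdvd s j) (by exact_mod_cast hq.ne')]
        push_cast
        rw [Finset.sum_div]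
        exact Finset.sum_congr rfl fun l _ => by ring
    rw [h]
    exact (Matrix.rank_mul_le_left _ _).trans (Matrix.rank_le_width _)

theorem det_ne_zero_of_mem {κ m M q : ℕ} {u : Fin (κ + 1) → ℕ}
    {X : Fin (κ + 1 + (m + 1)) → Fin (κ + 1) → ℕ}
    (hX : ∀ j, X j ∈ congruencePoints M q u (dominantOffset κ m M j)) :
    (Matrix.of fun j l : Fin (κ + 1) => (X (Fin.castAdd (m + 1) j) l : ℝ)).det ≠ 0 := by
  have hXbox : ∀ j l, dominantOffset κ m M j l < X j l ∧
      X j l ≤ dominantOffset κ m M j l + M := fun j l => Finset.mem_Ioc.1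
    (Fintype.mem_piFinset.1 (Finset.mem_filter.1 (hX j)).1 l)
  refine det_ne_zero_of_sum_row_lt_diag fun j => ?_
  simp only [Matrix.of_apply, Real.norm_natCast]
  have h1 := (hXbox (Fin.castAdd (m + 1) j) j).1
  rw [dominantOffset, if_pos rfl] at h1
  have h2 : ∑ l ∈ Finset.univ.erase j, X (Fin.castAdd (m + 1) j) l ≤ (κ + 1) * M := by
    calc _ ≤ ∑ l ∈ Finset.univ.erase j, M := by
          refine Finset.sum_le_sum fun l hl => ?_
          have h3 := (hXbox (Fin.castAdd (m + 1) j) l).2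
          rwa [dominantOffset, if_neg (fun h => (Finset.mem_erase.1 hl).1
            (Fin.castAdd_injective _ _ h).symm), zero_add] at h3
      _ ≤ (κ + 1) * M := by
          rw [Finset.sum_const, smul_eq_mul, Finset.card_erase_of_mem (Finset.mem_univ _)]
          refine Nat.mul_le_mul_right _ ?_
          simp
  exact_mod_cast h2.trans_lt h1

/-- The top rows reveal `X`; the invertible dominant block then determines the quotients `C / q`,
and coprimality of the corner with `q` recovers the denominator. -/
theorem extendByNumerators_injective {κ m M q q' : ℕ} (hq : 0 < q) (hq' : 0 < q')
    {C C' : Fin (m + 1) → Fin (κ + 1) → ℕ} (hC : C ∈ proportionalNumerators κ m q)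
    (hC' : C' ∈ proportionalNumerators κ m q')
    {X X' : Fin (κ + 1 + (m + 1)) → Fin (κ + 1) → ℕ}
    (hX : ∀ j, X j ∈ congruencePoints M q (C 0) (dominantOffset κ m M j))
    (hX' : ∀ j, X' j ∈ congruencePoints M q' (C' 0) (dominantOffset κ m M j))
    (h : extendByNumerators q C X = extendByNumerators q' C' X') :
    q = q' ∧ C = C' ∧ X = X' := by
  have hXX : X = X' := by
    funext j l
    simpa [extendByNumerators] using congrFun (congrFun h (Fin.castAdd (m + 1) l)) j
  subst hXX
  have hrow : ∀ s l, q' * C s l = q * C' s l := by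
    intro s
    have h1 : (Matrix.of fun j l : Fin (κ + 1) => (X (Fin.castAdd (m + 1) j) l : ℝ)).mulVec
        (fun l => (q' : ℝ) * C s l - q * C' s l) = 0 := by
      funext j
      have h2 := congrFun (congrFun h (Fin.natAdd (κ + 1) s)) (Fin.castAdd (m + 1) j)
      simp only [extendByNumerators, Fin.append_right] at h2
      have e1 := Nat.mul_div_cancel' (dvd_sum_of_mem hC (hX (Fin.castAdd (m + 1) j)) s)
      have e2 := Nat.mul_div_cancel' (dvd_sum_of_mem hC' (hX' (Fin.castAdd (m + 1) j)) s)
      have h3 : q' * ∑ l, C s l * X (Fin.castAdd (m + 1) j) l =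
          q * ∑ l, C' s l * X (Fin.castAdd (m + 1) j) l := by
        rw [← e1, ← e2, h2]; ring
      have h4 : (q' : ℝ) * ∑ l, (C s l : ℝ) * X (Fin.castAdd (m + 1) j) l =
          q * ∑ l, (C' s l : ℝ) * X (Fin.castAdd (m + 1) j) l := by exact_mod_cast h3
      rw [Finset.mul_sum, Finset.mul_sum, ← sub_eq_zero, ← Finset.sum_sub_distrib] at h4
      simp only [Matrix.mulVec, dotProduct, Matrix.of_apply, Pi.zero_apply]
      rw [← h4]
      exact Finset.sum_congr rfl fun l _ => by ring
    intro l
    have h5 := congrFun (Matrix.eq_zero_of_mulVec_eq_zero (det_ne_zero_of_mem hX) h1) l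
    have h6 : (q' : ℝ) * C s l = q * C' s l := sub_eq_zero.1 h5
    exact_mod_cast h6
  have hcop := (Finset.mem_filter.1 hC).2.1
  have hcop' := (Finset.mem_filter.1 hC').2.1
  have hqq : q = q' := by
    apply Nat.dvd_antisymm
    · exact hcop.dvd_of_dvd_mul_right (hrow 0 0 ▸ dvd_mul_right q _)
    · exact hcop'.dvd_of_dvd_mul_right (hrow 0 0 ▸ dvd_mul_right q' _)
  subst hqq
  refine ⟨rfl, ?_, rfl⟩
  funext s l
  exact Nat.eq_of_mul_eq_mul_left hq (hrow s l)

theorem sum_le_ncard_lowRankMatrices {κ m M n : ℕ} (hM : 2 * (κ + 1) * M ≤ n) :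
    ∑ q ∈ Finset.Icc 1 M, q.totient * q ^ (κ + m) * (M ^ κ * (M / q)) ^ (κ + 1 + (m + 1)) ≤
      (lowRankMatrices n (κ + 1 + (m + 1)) (κ + 1 + (m + 1)) (κ + 1)).ncard := by
  let Xs : ℕ → (Fin (m + 1) → Fin (κ + 1) → ℕ) →
      Finset (Fin (κ + 1 + (m + 1)) → Fin (κ + 1) → ℕ) := fun q C =>
    Fintype.piFinset fun j => congruencePoints M q (C 0) (dominantOffset κ m M j)
  let I : Finset (Σ _ : ℕ, Σ _ : Fin (m + 1) → Fin (κ + 1) → ℕ,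
      Fin (κ + 1 + (m + 1)) → Fin (κ + 1) → ℕ) :=
    (Finset.Icc 1 M).sigma fun q => (proportionalNumerators κ m q).sigma fun C => Xs q C
  have hI : ∀ p ∈ I, 0 < p.1 ∧ p.2.1 ∈ proportionalNumerators κ m p.1 ∧
      ∀ j, p.2.2 j ∈ congruencePoints M p.1 (p.2.1 0) (dominantOffset κ m M j) := by
    intro p hp
    obtain ⟨h1, h2⟩ := Finset.mem_sigma.1 hp
    obtain ⟨h3, h4⟩ := Finset.mem_sigma.1 h2
    exact ⟨(Finset.mem_Icc.1 h1).1, h3, Fintype.mem_piFinset.1 h4⟩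
  have hcard : ∑ q ∈ Finset.Icc 1 M,
      q.totient * q ^ (κ + m) * (M ^ κ * (M / q)) ^ (κ + 1 + (m + 1)) ≤ I.card := by
    simp only [I, Finset.card_sigma]
    refine Finset.sum_le_sum fun q hq => ?_
    have hq0 : 0 < q := (Finset.mem_Icc.1 hq).1
    calc _ ≤ (proportionalNumerators κ m q).card * (M ^ κ * (M / q)) ^ (κ + 1 + (m + 1)) :=
          Nat.mul_le_mul_right _ (le_card_proportionalNumerators κ m hq0)
      _ = ∑ C ∈ proportionalNumerators κ m q, (M ^ κ * (M / q)) ^ (κ + 1 + (m + 1)) := by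
          rw [Finset.sum_const, smul_eq_mul]
      _ ≤ _ := by
          refine Finset.sum_le_sum fun C hC => ?_
          rw [Fintype.card_piFinset]
          calc (M ^ κ * (M / q)) ^ (κ + 1 + (m + 1)) =
                ∏ _j : Fin (κ + 1 + (m + 1)), M ^ κ * (M / q) := by simp
            _ ≤ _ := Finset.prod_le_prod' fun j _ =>
                le_card_congruencePoints M hq0 (C 0) _ (Finset.mem_filter.1 hC).2.1
  refine hcard.trans ?_
  rw [← Set.ncard_coe_finset]
  refine Set.ncard_le_ncard_of_injOn (fun p => extendByNumerators p.1 p.2.1 p.2.2) ?_ ?_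
    (lowRankMatrices_finite _ _ _ _)
  · intro p hp
    obtain ⟨h1, h2, h3⟩ := hI p hp
    exact extendByNumerators_mem h1 hM h2 id h3
  · rintro ⟨q, C, X⟩ hp ⟨q', C', X'⟩ hp' h
    obtain ⟨h1, h2, h3⟩ := hI _ hp
    obtain ⟨h1', h2', h3'⟩ := hI _ hp'
    obtain ⟨rfl, rfl, rfl⟩ := extendByNumerators_injective h1 h1' h2 h2' h3 h3' h
    rfl

theorem le_ncard_lowRankMatrices_square (κ m : ℕ) :
    ∃ c : ℝ, 0 < c ∧ ∀ᶠ n : ℕ in atTop,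
      c * ((n : ℝ) ^ ((κ + 1) * (κ + 1 + (m + 1))) * Real.log n) ≤
        ((lowRankMatrices n (κ + 1 + (m + 1)) (κ + 1 + (m + 1)) (κ + 1)).ncard : ℝ) := by
  set d := κ + 1 + (m + 1) with hd
  set K := 2 * (κ + 1) with hK
  have hK0 : 0 < K := by positivity
  refine ⟨(1 / (2 * K : ℝ)) ^ ((κ + 1) * d) * (1 / 2) ^ d * (1 / 4), by positivity, ?_⟩
  -- Requiring `n ≥ K^2` gives `log (n / K) ≥ (log n) / 2`.
  filter_upwards [eventually_ge_atTop (K ^ 2), eventually_ge_atTop 1] with n hn hn1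
  have hKn : K ≤ n := (Nat.le_self_pow two_ne_zero K).trans hn
  set M := n / K with hMdef
  have hM0 : 0 < M := Nat.div_pos hKn hK0
  have hn0 : (0 : ℝ) < n := by exact_mod_cast hn1
  have hKr : (0 : ℝ) < K := by exact_mod_cast hK0
  have hnM : (n : ℝ) / K ≤ M + 1 := by
    rw [div_le_iff₀ hKr]
    have := (Nat.lt_mul_div_succ n hK0).le
    rw [mul_comm]
    exact_mod_cast this
  have hMn : 1 / (2 * K : ℝ) * n ≤ M := by
    have h1 : (1 : ℝ) ≤ M := by exact_mod_cast hM0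
    have h2 : 1 / (2 * K : ℝ) * n = (n / K) / 2 := by field_simp
    rw [h2]
    linarith
  have hlog : Real.log n / 2 ≤ Real.log (M + 1) := by
    have h1 : Real.log (n / K) ≤ Real.log (M + 1) := Real.log_le_log (by positivity) hnM
    have h2 : 2 * Real.log K ≤ Real.log n := by
      have : Real.log ((K : ℝ) ^ 2) ≤ Real.log n :=
        Real.log_le_log (by positivity) (by exact_mod_cast hn)
      rwa [Real.log_pow, Nat.cast_ofNat] at this
    rw [Real.log_div hn0.ne' hKr.ne'] at h1
    linarith
  have hsum : ((∑ q ∈ Finset.Icc 1 M, q.totient * q ^ (κ + m) * (M ^ κ * (M / q)) ^ d : ℕ) : ℝ) ≤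
      ((lowRankMatrices n d d (κ + 1)).ncard : ℝ) := by
    exact_mod_cast sum_le_ncard_lowRankMatrices (Nat.mul_div_le n K)
  refine le_trans ?_ hsum
  push_cast
  calc (1 / (2 * K : ℝ)) ^ ((κ + 1) * d) * (1 / 2) ^ d * (1 / 4) *
        ((n : ℝ) ^ ((κ + 1) * d) * Real.log n)
      = (1 / (2 * K : ℝ) * n) ^ ((κ + 1) * d) * (1 / 2) ^ d * (Real.log n / 2 / 2) := by
        rw [mul_pow]; ring
    _ ≤ (M : ℝ) ^ ((κ + 1) * d) * (1 / 2) ^ d * (Real.log (M + 1) / 2) := by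
        have : 0 ≤ Real.log n := Real.log_natCast_nonneg n
        gcongr
    _ ≤ (M : ℝ) ^ ((κ + 1) * d) * (1 / 2) ^ d *
          ∑ q ∈ Finset.Icc 1 M, (Nat.totient q : ℝ) / (q : ℝ) ^ 2 :=
        mul_le_mul_of_nonneg_left (log_le_sum_totient M) (by positivity)
    _ ≤ _ := by
        rw [Finset.mul_sum]
        refine Finset.sum_le_sum fun q hq => ?_
        obtain ⟨hq1, hqM⟩ := Finset.mem_Icc.1 hq
        have hq0 : (0 : ℝ) < q := by exact_mod_cast hq1
        -- Since `q ≤ M`, the quotient is at least 1 and the floor loses at most a factor 2.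
        have hfloor : (M : ℝ) / (2 * q) ≤ ((M / q : ℕ) : ℝ) := by
          have h1 : 1 ≤ M / q := Nat.div_pos hqM hq1
          have h2 := (Nat.lt_mul_div_succ M hq1).le
          have h3 : (M : ℝ) ≤ q * ((M / q : ℕ) + 1) := by exact_mod_cast h2
          have h4 : (1 : ℝ) ≤ ((M / q : ℕ) : ℝ) := by exact_mod_cast h1
          rw [div_le_iff₀ (by positivity)]
          nlinarith
        calc (M : ℝ) ^ ((κ + 1) * d) * (1 / 2) ^ d * ((Nat.totient q : ℝ) / (q : ℝ) ^ 2)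
            = (Nat.totient q : ℝ) * (q : ℝ) ^ (κ + m) * ((M : ℝ) ^ κ * (M / (2 * q))) ^ d := by
              have e1 : (M : ℝ) ^ κ * (M / (2 * q)) = M ^ (κ + 1) * (1 / 2) * (1 / q) := by
                rw [pow_succ]; field_simp
              have e2 : (1 / (q : ℝ)) ^ d = 1 / (q ^ (κ + m) * q ^ 2) := by
                rw [one_div_pow, ← pow_add, hd]
                congr 2
                omega
              rw [e1, mul_pow, mul_pow, e2, ← pow_mul]
              field_simp
          _ ≤ _ := by gcongr

/-! ### Combining the bounds -/

theorem ncard_lowRankMatrices_isTheta {a b k : ℕ} (hk : 0 < k) (hka : k < a) (hab : a ≤ b) :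
    (fun n : ℕ => ((lowRankMatrices n a b k).ncard : ℝ)) =Θ[atTop]
      fun n : ℕ => (n : ℝ) ^ (k * b) * if a = b then Real.log n else 1 := by
  constructor
  · obtain ⟨C, -, hC⟩ := ncard_lowRankMatrices_le hab hka.le
    refine IsBigO.of_bound C ?_
    filter_upwards [eventually_ge_atTop 3] with n hn
    rw [Real.norm_natCast]
    refine (hC n hn).trans_eq ?_
    rw [Real.norm_of_nonneg]
    refine mul_nonneg (by positivity) ?_
    split_ifs
    · exact Real.log_natCast_nonneg n
    · exact zero_le_one
  · by_cases h : a = b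
    · subst h
      obtain ⟨κ, rfl⟩ : ∃ κ, k = κ + 1 := ⟨k - 1, by omega⟩
      obtain ⟨m, rfl⟩ : ∃ m, a = κ + 1 + (m + 1) := ⟨a - (κ + 1) - 1, by omega⟩
      obtain ⟨c, hc, hle⟩ := le_ncard_lowRankMatrices_square κ m
      refine IsBigO.of_bound c⁻¹ ?_
      filter_upwards [hle] with n hn
      rw [if_pos rfl, Real.norm_natCast, Real.norm_of_nonneg
        (mul_nonneg (by positivity) (Real.log_natCast_nonneg n)), inv_mul_eq_div, le_div_iff₀ hc,
        mul_comm]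
      exact hn
    · refine IsBigO.of_bound 1 (Eventually.of_forall fun n => ?_)
      rw [if_neg h, mul_one, one_mul, Real.norm_natCast, Real.norm_of_nonneg (by positivity)]
      exact_mod_cast pow_le_ncard_lowRankMatrices n b hk hka.le

theorem proposition1p9 (d k r : ℕ) (hk : 0 < k) (hkdr : k < min d r) :
    (fun n : ℕ => (linearCount n d k r : ℝ)) =Θ[atTop] (fun n : ℕ => linearGrowth d k r n) := by
  have hkd : k < d := hkdr.trans_le (min_le_left _ _)
  have hkr : k < r := hkdr.trans_le (min_le_right _ _)
  simp only [linearCount_eq_ncard_lowRankMatrices _ r hkd.le]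
  rcases le_total r d with h | h
  · refine (ncard_lowRankMatrices_isTheta hk hkr h).trans_eventuallyEq (Eventually.of_forall fun n => ?_)
    dsimp only
    rw [linearGrowth, max_eq_right h]
    by_cases hrd : r = d <;> simp [hrd]
  · simp only [ncard_lowRankMatrices_comm _ r d]
    refine (ncard_lowRankMatrices_isTheta hk hkd h).trans_eventuallyEq (Eventually.of_forall fun n => ?_)
    dsimp only
    rw [linearGrowth, max_eq_left h]
    by_cases hrd : r = d
    · simp [hrd]
    · simp [hrd, Ne.symm hrd]
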